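/- Let $k$ be an algebraically closed field. A \emph{tensor category} over $k$ is a $k$-linear abelian rigid monoidal category with $k$-bilinear tensor product, in which all objects have finite length, all Hom spaces are finite dimensional and the unit object $\mathbf 1$ is simple. Let $(G,\Gamma)$ be a matched pair of finite groups: a left action $\rhd:\Gamma\times G\to G$ of $\Gamma$ on the set $G$ and a right action $\lhd:\Gamma\times G\to\Gamma$ of $G$ on the set $\Gamma$ with $s\rhd gh=(s\rhd g)((s\lhd g)\rhd h)$ and $st\lhd g=(s\lhd(t\rhd g))(t\lhd g)$. Let $\mathcal C$ be a $(G,\Gamma)$-crossed tensor category over $k$, that is, a tensor category with the following data (associativity and unit isomorphisms of $\mathcal C$ are suppressed). 1. A $\Gamma$-grading $\mathcal C=\bigoplus_{s\in\Gamma}\mathcal C_s$: full replete subcategories such that every object is a direct sum of objects $X_s\in\mathcal C_s$, $\operatorname{Hom}(X,Y)=0$ for $X\in\mathcal C_s$, $Y\in\mathcal C_t$, $s\ne t$, and $\mathcal C_s\otimes\mathcal C_t\subseteq\mathcal C_{st}$. 2. A right action $\rho$ of $G$ on $\mathcal C$ by $k$-linear autoequivalences $\rho^g$, with natural isomorphisms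 $\rho_2^{g,h}:\rho^g\rho^h\to\rho^{hg}$ and $\rho_0:\mathrm{id}\to\rho^e$ satisfying the usual associativity and unit conditions, such that $\rho^g(\mathcal C_s)=\mathcal C_{s\lhd g}$ (up to isomorphism of objects). 3. Isomorphisms $\gamma^g_{X,Y}:\rho^g(X\otimes Y)\to\rho^{t\rhd g}(X)\otimes\rho^g(Y)$, natural in $X\in\mathcal C$ and $Y\in\mathcal C_t$, and isomorphisms $\gamma^g_0:\rho^g(\mathbf 1)\to\mathbf 1$, such that for all $g,h\in G$, $X\in\mathcal C$, $Y\in\mathcal C_s$, $Z\in\mathcal C_t$: (a) $(\gamma^{t\rhd g}_{X,Y}\otimes\mathrm{id})\,\gamma^g_{X\otimes Y,Z}=(\mathrm{id}\otimes\gamma^g_{Y,Z})\,\gamma^g_{X,Y\otimes Z}$; (b) $(\mathrm{id}\otimes\gamma^g_0)\,\gamma^g_{X,\mathbf 1}=\mathrm{id}_{\rho^g(X)}$ and $(\gamma^{s\rhd g}_0\otimes\mathrm{id})\,\gamma^g_{\mathbf 1,Y}=\mathrm{id}_{\rho^g(Y)}$; (c) $\gamma^{hg}_{X,Y}\,(\rho_2^{g,h})_{X\otimes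 Y}=\big((\rho_2^{(s\lhd h)\rhd g,\,s\rhd h})_X\otimes(\rho_2^{g,h})_Y\big)\,\gamma^g_{\rho^{s\rhd h}(X),\rho^h(Y)}\,\rho^g(\gamma^h_{X,Y})$; (d) $\gamma^{hg}_0\,(\rho_2^{g,h})_{\mathbf 1}=\gamma^g_0\,\rho^g(\gamma^h_0)$; (e) $\gamma^e_{X,Y}\,(\rho_0)_{X\otimes Y}=(\rho_0)_X\otimes(\rho_0)_Y$ and $\gamma^e_0\,(\rho_0)_{\mathbf 1}=\mathrm{id}_{\mathbf 1}$. Let $\mathcal C^G$ be the equivariantization of $\mathcal C$ under $\rho$: its objects are pairs $(X,r)$ with isomorphisms $r^g:\rho^g(X)\to X$ such that $r^g\rho^g(r^h)=r^{hg}(\rho_2^{g,h})_X$ and $r^e(\rho_0)_X=\mathrm{id}_X$, and its morphisms $(X,r)\to(Y,r')$ are the $f:X\to Y$ with $fr^g=r'^g\rho^g(f)$ for all $g$. Then $\mathcal C^G$, with its $k$-linear structure inherited from $\mathcal C$, is a tensor category over $k$, denoted $\mathcal C^{(G,\Gamma)}$, with tensor product $$(X,r)\otimes(Y,r')=(X\otimes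 Y,\tilde r)$$ and unit object $(\mathbf 1,(\gamma^g_0)_{g\in G})$, where for any decomposition $Y=\bigoplus_{s\in\Gamma}Y_s$, $Y_s\in\mathcal C_s$, the morphism $\tilde r^g$ is the composition $$\bigoplus_s\rho^g(X\otimes Y_s)\xrightarrow{\oplus_s\gamma^g_{X,Y_s}}\bigoplus_s\rho^{s\rhd g}(X)\otimes\rho^g(Y_s)\xrightarrow{\oplus_s r^{s\rhd g}\otimes r'^g_s}\bigoplus_sX\otimes Y_{s\lhd g}=X\otimes Y,$$ with $r'^g_s:\rho^g(Y_s)\to Y_{s\lhd g}$ the restriction of $r'^g$; the forgetful functor $\mathcal C^{(G,\Gamma)}\to\mathcal C$ is strict monoidal. Moreover, the monad $T=\bigoplus_{g\in G}\rho^g$ on $\mathcal C$, with multiplication and unit induced by $\rho_2$ and $\rho_0$, is a Hopf monad (a bimonad whose left and right fusion operators are isomorphisms) with respect to the comonoidal structure $T_2(X,Y):T(X\otimes Y)\to T(X)\otimes T(Y)$, $T_0:T(\mathbf 1)\to\mathbf 1$ given by the $\gamma^g_{X,Y_s}$ and the $\gamma^g_0$. The functor $(X,r)\mapsto(X,\,(r^g)_{g}:T(X)\to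 X)$ is an equivalence from $\mathcal C^{(G,\Gamma)}$ to the category of $T$-modules, and under it the tensor product corresponds to $(X,a)\otimes(Y,b)=(X\otimes Y,(a\otimes b)T_2(X,Y))$. -/

import Mathlib

open CategoryTheory Category Limits MonoidalCategory

universe w v u

noncomputable section

namespace CrossedTensor

/-- A matched pair of groups `(G, Γ)`: a left action `s ▷ g` of `Γ` on the set `G` and a right
action `s ◁ g` of `G` on the set `Γ`, compatible with each other. -/
structure MatchedPair (G Γ : Type*) [Group G] [Group Γ] where
  /-- `left s g` is `s ▷ g` -/
  left : Γ → G → G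
  /-- `right s g` is `s ◁ g` -/
  right : Γ → G → Γ
  one_left : ∀ g, left 1 g = g
  mul_left : ∀ s t g, left (s * t) g = left s (left t g)
  right_one : ∀ s, right s 1 = s
  right_mul : ∀ s g h, right s (g * h) = right (right s g) h
  left_mul : ∀ s g h, left s (g * h) = left s g * left (right s g) h
  mul_right : ∀ s t g, right (s * t) g = right s (left t g) * right t g

lemma MatchedPair.left_one {G Γ : Type*} [Group G] [Group Γ] (M : MatchedPair G Γ) (s : Γ) :
    M.left s 1 = 1 := by
  have h := M.left_mul s 1 1
  rw [M.right_one, mul_one] at h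
  exact left_eq_mul.mp h

/-- `C` is a tensor category over `k`: abelian, with `k`-bilinear tensor product, rigid
(all left and right duals exist), locally finite, with simple unit object. -/
structure IsTensorCategory (k : Type w) [Field k] (C : Type u) [Category.{v} C]
    [P : Preadditive C] [Linear k C] [MonoidalCategory C] : Prop where
  abelian : ∃ A : Abelian C, A.toPreadditive = P
  tensor_bilinear : ∃ _ : MonoidalPreadditive C, MonoidalLinear k C
  rigid : Nonempty (RigidCategory C)
  noetherian : ∀ X : C, IsNoetherianObject X
  artinian : ∀ X : C, IsArtinianObject X
  finite_hom : ∀ X Y : C, Module.Finite k (X ⟶ Y)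
  simple_unit : Simple (𝟙_ C)

/-! ### Right actions and equivariant objects -/

section Action

variable (k : Type w) [Field k] (G : Type*) [Group G]
  (C : Type u) [Category.{v} C] [Preadditive C] [Linear k C]

/-- A right action of `G` on `C` by `k`-linear autoequivalences. Here `mul g h` is the natural
isomorphism from `ρ^g ∘ ρ^h` to `ρ^{hg}` (Mathlib composes functors from left to right). -/
structure RightAction where
  functor : G → C ⥤ C
  isEquivalence : ∀ g, (functor g).IsEquivalence
  additive : ∀ g, (functor g).Additive
  linear : ∀ g, (functor g).Linear k
  mul : ∀ g h : G, functor h ⋙ functor g ≅ functor (h * g)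
  one : 𝟭 C ≅ functor 1
  mul_coherence : ∀ (a b c : G) (X : C),
    (mul a b).hom.app ((functor c).obj X) ≫ (mul (b * a) c).hom.app X =
      (functor a).map ((mul b c).hom.app X) ≫ (mul a (c * b)).hom.app X ≫
        eqToHom (by rw [mul_assoc])
  map_one_coherence : ∀ (a : G) (X : C),
    (functor a).map (one.hom.app X) ≫ (mul a 1).hom.app X = eqToHom (by simp)
  one_coherence : ∀ (a : G) (X : C),
    one.hom.app ((functor a).obj X) ≫ (mul 1 a).hom.app X = eqToHom (by simp)

variable {k G C} (ρ : RightAction k G C)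

attribute [instance] RightAction.isEquivalence RightAction.additive RightAction.linear

/-- The identity morphism `ρ^a(X) = ρ^b(X)` for equal `a` and `b`. -/
def RightAction.cast {a b : G} (h : a = b) (X : C) :
    (ρ.functor a).obj X ⟶ (ρ.functor b).obj X :=
  eqToHom (by rw [h])

/-- `G`-equivariant objects `(X, r)`. -/
structure EquivariantObject where
  obj : C
  act : ∀ g : G, (ρ.functor g).obj obj ⟶ obj
  isIso_act : ∀ g, IsIso (act g)
  act_mul : ∀ g h, (ρ.functor g).map (act h) ≫ act g = (ρ.mul g h).hom.app obj ≫ act (h * g)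
  act_one : ρ.one.hom.app obj ≫ act 1 = 𝟙 obj

namespace EquivariantObject

variable {ρ}

/-- `G`-equivariant morphisms. -/
@[ext]
structure Hom (A B : EquivariantObject ρ) where
  hom : A.obj ⟶ B.obj
  comm : ∀ g, A.act g ≫ hom = (ρ.functor g).map hom ≫ B.act g

instance : Category (EquivariantObject ρ) where
  Hom := Hom
  id A := ⟨𝟙 A.obj, by simp⟩
  comp f f' := ⟨f.hom ≫ f'.hom, fun g => by
    rw [← assoc, f.comm, assoc, f'.comm, Functor.map_comp, assoc]⟩
  id_comp f := Hom.ext (Category.id_comp f.hom)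
  comp_id f := Hom.ext (Category.comp_id f.hom)
  assoc f f' f'' := Hom.ext (Category.assoc f.hom f'.hom f''.hom)

@[ext]
lemma hom_ext {A B : EquivariantObject ρ} {f f' : A ⟶ B} (h : f.hom = f'.hom) : f = f' :=
  Hom.ext h

@[simp] lemma id_hom (A : EquivariantObject ρ) : Hom.hom (𝟙 A) = 𝟙 A.obj := rfl

@[simp] lemma comp_hom {A B D : EquivariantObject ρ} (f : A ⟶ B) (f' : B ⟶ D) :
    (f ≫ f').hom = f.hom ≫ f'.hom := rfl

variable {A B : EquivariantObject ρ}

instance : Add (A ⟶ B) := ⟨fun f f' => ⟨f.hom + f'.hom, fun g => by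
  rw [Preadditive.comp_add, f.comm, f'.comm, Functor.map_add, Preadditive.add_comp]⟩⟩

instance : Zero (A ⟶ B) := ⟨⟨0, by simp⟩⟩

instance : Neg (A ⟶ B) := ⟨fun f => ⟨-f.hom, fun g => by
  rw [Preadditive.comp_neg, f.comm, Functor.map_neg, Preadditive.neg_comp]⟩⟩

instance : SMul k (A ⟶ B) := ⟨fun c f => ⟨c • f.hom, fun g => by
  rw [Linear.comp_smul, f.comm, Functor.map_smul, Linear.smul_comp]⟩⟩

@[simp] lemma add_hom (f f' : A ⟶ B) : (f + f').hom = f.hom + f'.hom := rfl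
@[simp] lemma zero_hom : Hom.hom (0 : A ⟶ B) = 0 := rfl
@[simp] lemma neg_hom (f : A ⟶ B) : (-f).hom = -f.hom := rfl
@[simp] lemma smul_hom (c : k) (f : A ⟶ B) : (c • f).hom = c • f.hom := rfl

instance : AddCommGroup (A ⟶ B) where
  add_assoc f f' f'' := hom_ext (add_assoc f.hom f'.hom f''.hom)
  zero_add f := hom_ext (zero_add f.hom)
  add_zero f := hom_ext (add_zero f.hom)
  add_comm f f' := hom_ext (add_comm f.hom f'.hom)
  neg_add_cancel f := hom_ext (neg_add_cancel f.hom)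
  nsmul := nsmulRec
  zsmul := zsmulRec

/-- Equivariant morphisms are added as morphisms of `C`. -/
instance : Preadditive (EquivariantObject ρ) where
  add_comp _ _ _ f f' f'' := hom_ext (Preadditive.add_comp _ _ _ f.hom f'.hom f''.hom)
  comp_add _ _ _ f f' f'' := hom_ext (Preadditive.comp_add _ _ _ f.hom f'.hom f''.hom)

instance : Module k (A ⟶ B) where
  one_smul f := hom_ext (one_smul k f.hom)
  mul_smul a b f := hom_ext (mul_smul a b f.hom)
  smul_zero a := hom_ext (smul_zero a)
  smul_add a f f' := hom_ext (smul_add a f.hom f'.hom)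
  add_smul a b f := hom_ext (add_smul a b f.hom)
  zero_smul f := hom_ext (zero_smul k f.hom)

instance : Linear k (EquivariantObject ρ) where
  smul_comp _ _ _ a f f' := hom_ext (Linear.smul_comp _ _ _ a f.hom f'.hom)
  comp_smul _ _ _ f a f' := hom_ext (Linear.comp_smul _ _ _ f.hom a f'.hom)

variable (ρ) in
/-- The forgetful functor `(X, r) ↦ X`. -/
def forget : EquivariantObject ρ ⥤ C where
  obj A := A.obj
  map f := f.hom

end EquivariantObject

/-! ### The monad of a right action of a finite group -/

variable [HasFiniteBiproducts C] [Fintype G]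

/-- The endofunctor `T = ⨁ g, ρ^g`. -/
def RightAction.sumFunctor : C ⥤ C where
  obj X := ⨁ fun g : G => (ρ.functor g).obj X
  map f := biproduct.map fun g => (ρ.functor g).map f

/-- The inclusion of the summand `ρ^g(X)` in `T(X)`. -/
def RightAction.incl (X : C) (g : G) : (ρ.functor g).obj X ⟶ ρ.sumFunctor.obj X :=
  biproduct.ι (fun g : G => (ρ.functor g).obj X) g

/-- The projection of `T(X)` to the summand `ρ^g(X)`. -/
def RightAction.proj (X : C) (g : G) : ρ.sumFunctor.obj X ⟶ (ρ.functor g).obj X :=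
  biproduct.π (fun g : G => (ρ.functor g).obj X) g

/-- The morphism out of `T(X)` with given components. -/
def RightAction.desc {X Z : C} (f : ∀ g : G, (ρ.functor g).obj X ⟶ Z) :
    ρ.sumFunctor.obj X ⟶ Z :=
  biproduct.desc f

lemma RightAction.incl_desc {X Z : C} (f : ∀ g : G, (ρ.functor g).obj X ⟶ Z) (g : G) :
    ρ.incl X g ≫ ρ.desc f = f g :=
  biproduct.ι_desc f g

lemma RightAction.incl_map {X Y : C} (f : X ⟶ Y) (g : G) :
    ρ.incl X g ≫ ρ.sumFunctor.map f = (ρ.functor g).map f ≫ ρ.incl Y g :=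
  biproduct.ι_map (fun g => (ρ.functor g).map f) g

lemma RightAction.sum_hom_ext {X Z : C} {a b : ρ.sumFunctor.obj X ⟶ Z}
    (h : ∀ g, ρ.incl X g ≫ a = ρ.incl X g ≫ b) : a = b :=
  biproduct.hom_ext' a b h

lemma RightAction.incl_proj_self (X : C) (g : G) : ρ.incl X g ≫ ρ.proj X g = 𝟙 _ :=
  biproduct.ι_π_self _ g

lemma RightAction.incl_proj_ne (X : C) {g h : G} (hgh : g ≠ h) : ρ.incl X g ≫ ρ.proj X h = 0 :=
  biproduct.ι_π_ne _ hgh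

lemma RightAction.sum_total (X : C) : ∑ g, ρ.proj X g ≫ ρ.incl X g = 𝟙 _ := by
  refine ρ.sum_hom_ext fun g => ?_
  rw [Preadditive.comp_sum, Finset.sum_eq_single g, ← assoc, incl_proj_self]
  · simp
  · intro b _ hb
    rw [← assoc, ρ.incl_proj_ne X hb.symm, zero_comp]
  · simp

lemma RightAction.map_sum_hom_ext {X Z : C} (F : C ⥤ C) [F.Additive]
    {a b : F.obj (ρ.sumFunctor.obj X) ⟶ Z}
    (h : ∀ g, F.map (ρ.incl X g) ≫ a = F.map (ρ.incl X g) ≫ b) : a = b := by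
  have e : 𝟙 (F.obj (ρ.sumFunctor.obj X)) = ∑ g, F.map (ρ.proj X g) ≫ F.map (ρ.incl X g) := by
    rw [← F.map_id, ← ρ.sum_total X, F.map_sum]
    simp only [F.map_comp]
  rw [← Category.id_comp a, ← Category.id_comp b, e, Preadditive.sum_comp, Preadditive.sum_comp]
  simp only [Category.assoc, h]

/-- The unit of `T`: `ρ_0` followed by the inclusion of `ρ^e`. -/
def RightAction.unitApp (X : C) : X ⟶ ρ.sumFunctor.obj X :=
  ρ.one.hom.app X ≫ ρ.incl X 1

/-- The multiplication of `T`, with components `ρ^g ρ^h ⟶ ρ^{hg}`. -/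
def RightAction.mulApp (X : C) : ρ.sumFunctor.obj (ρ.sumFunctor.obj X) ⟶ ρ.sumFunctor.obj X :=
  ρ.desc fun g => ∑ h : G,
    (ρ.functor g).map (ρ.proj X h) ≫ (ρ.mul g h).hom.app X ≫ ρ.incl X (h * g)

lemma RightAction.incl_mulApp (X : C) (g h : G) :
    (ρ.functor g).map (ρ.incl X h) ≫ ρ.incl (ρ.sumFunctor.obj X) g ≫ ρ.mulApp X =
      (ρ.mul g h).hom.app X ≫ ρ.incl X (h * g) := by
  rw [RightAction.mulApp, incl_desc, Preadditive.comp_sum, Finset.sum_eq_single h]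
  · rw [← Functor.map_comp_assoc, incl_proj_self]; simp
  · intro b _ hb
    rw [← Functor.map_comp_assoc, ρ.incl_proj_ne X hb.symm]; simp
  · simp

lemma RightAction.eqToHom_incl (X : C) {a b : G} (h : a = b)
    (h' : (ρ.functor a).obj X = (ρ.functor b).obj X) :
    eqToHom h' ≫ ρ.incl X b = ρ.incl X a := by
  subst h; simp

/-- The monad `T = ⨁ g, ρ^g` of the action. -/
def RightAction.monad : Monad C where
  toFunctor := ρ.sumFunctor
  η :=
    { app := ρ.unitApp
      naturality := fun X Y f => by
        simp only [unitApp, Functor.id_map, assoc, incl_map]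
        have := ρ.one.hom.naturality f
        simp only [Functor.id_map] at this
        rw [← assoc, this, assoc] }
  μ :=
    { app := ρ.mulApp
      naturality := fun X Y f => by
        refine ρ.sum_hom_ext fun g => ρ.map_sum_hom_ext _ fun h => ?_
        have := (ρ.mul g h).hom.naturality f
        simp only [Functor.comp_map] at this
        simp only [Functor.comp_map]
        rw [← assoc (ρ.incl _ g), incl_map, assoc, ← Functor.map_comp_assoc, incl_map,
          Functor.map_comp, assoc, incl_mulApp, ← assoc, this]
        rw [← assoc (ρ.incl _ g), ← assoc, incl_mulApp]
        simp only [assoc, incl_map] }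
  assoc X := by
    refine ρ.sum_hom_ext fun a => ρ.map_sum_hom_ext _ fun b =>
      ρ.map_sum_hom_ext (ρ.functor b ⋙ ρ.functor a) fun c => ?_
    simp only [Functor.comp_map, Functor.comp_obj]
    rw [← assoc (ρ.incl _ a), incl_map]
    simp only [assoc]
    rw [← Functor.map_comp_assoc, ← Functor.map_comp_assoc, assoc, incl_mulApp, Functor.map_comp, assoc,
      incl_mulApp]
    rw [← assoc (ρ.incl _ a), ← assoc ((ρ.functor a).map (ρ.incl _ b)), incl_mulApp, assoc]
    have := (ρ.mul a b).hom.naturality (ρ.incl X c)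
    simp only [Functor.comp_map] at this
    rw [← assoc _ ((ρ.mul a b).hom.app _), this, assoc, incl_mulApp,
      ← assoc ((ρ.mul a b).hom.app _), ρ.mul_coherence]
    simp only [assoc]
    rw [ρ.eqToHom_incl X (mul_assoc _ _ _)]
  left_unit X := by
    refine ρ.sum_hom_ext fun g => ?_
    have := ρ.one.hom.naturality (ρ.incl X g)
    simp only [Functor.id_map] at this
    dsimp only
    rw [unitApp, assoc, ← assoc, this, assoc, incl_mulApp, ← assoc, ρ.one_coherence,
      ρ.eqToHom_incl X (mul_one g).symm]
    exact (comp_id _).symm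
  right_unit X := by
    refine ρ.sum_hom_ext fun g => ?_
    dsimp only
    rw [← assoc, incl_map, unitApp, Functor.map_comp, assoc, assoc, incl_mulApp, ← assoc,
      ρ.map_one_coherence, ρ.eqToHom_incl X (one_mul g).symm]
    exact (comp_id _).symm

/-- An equivariant object `(X, r)` as a `T`-module: the morphism `T(X) ⟶ X` with components
`r^g`. -/
def RightAction.toModules : EquivariantObject ρ ⥤ ρ.monad.Algebra where
  obj A :=
    { A := A.obj
      a := ρ.desc A.act
      unit := by
        change ρ.unitApp A.obj ≫ _ = _
        rw [unitApp, assoc, incl_desc, A.act_one]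
      assoc := by
        change ρ.mulApp A.obj ≫ _ = ρ.sumFunctor.map _ ≫ _
        refine ρ.sum_hom_ext fun g => ρ.map_sum_hom_ext _ fun h => ?_
        rw [← assoc (ρ.incl _ g), ← assoc, incl_mulApp, assoc, incl_desc, ← assoc (ρ.incl _ g),
          incl_map, assoc, incl_desc, ← Functor.map_comp_assoc, incl_desc, A.act_mul] }
  map f :=
    { f := f.hom
      h := by
        change ρ.sumFunctor.map f.hom ≫ ρ.desc _ = ρ.desc _ ≫ f.hom
        refine ρ.sum_hom_ext fun g => ?_
        rw [← assoc, incl_map, assoc, incl_desc, ← assoc, incl_desc, f.comm] }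

end Action

/-! ### Hopf monads -/

section Hopf

variable {C : Type u} [Category.{v} C] [MonoidalCategory C]

/-- A monad `T` with a comonoidal structure on its underlying functor is a Hopf monad: the
multiplication and the unit are comonoidal transformations (so that `T` is a bimonad) and the left
and right fusion operators are isomorphisms. -/
structure IsHopfMonad (T : Monad C) (O : T.toFunctor.OplaxMonoidal) : Prop where
  mul_tensor : ∀ X Y : C, T.μ.app (X ⊗ Y) ≫ O.δ X Y =
    T.map (O.δ X Y) ≫ O.δ (T.obj X) (T.obj Y) ≫ (T.μ.app X ⊗ₘ T.μ.app Y)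
  mul_unit : T.μ.app (𝟙_ C) ≫ O.η = T.map O.η ≫ O.η
  unit_tensor : ∀ X Y : C, T.η.app (X ⊗ Y) ≫ O.δ X Y = T.η.app X ⊗ₘ T.η.app Y
  unit_unit : T.η.app (𝟙_ C) ≫ O.η = 𝟙 (𝟙_ C)
  left_fusion : ∀ X Y : C, IsIso (O.δ X (T.obj Y) ≫ T.obj X ◁ T.μ.app Y)
  right_fusion : ∀ X Y : C, IsIso (O.δ (T.obj X) Y ≫ T.μ.app X ▷ T.obj Y)

end Hopf

/-! ### Gradings and crossed actions -/

section Crossed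

variable (k : Type w) [Field k] {G Γ : Type*} [Group G] [Group Γ] [Fintype Γ]

/-- A decomposition `X ≅ ⨁ s, X_s` with `X_s` in the full subcategory `comp s`. -/
structure Decomposition {C : Type u} [Category.{v} C] [Preadditive C] [HasFiniteBiproducts C]
    (comp : Γ → ObjectProperty C) (X : C) where
  piece : Γ → C
  mem : ∀ s, comp s (piece s)
  iso : X ≅ ⨁ piece

namespace Decomposition

variable {C : Type u} [Category.{v} C] [Preadditive C] [HasFiniteBiproducts C]
  {comp : Γ → ObjectProperty C} {X : C} (D : Decomposition comp X)

/-- The inclusion of the homogeneous component `X_s`. -/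
def ι (s : Γ) : D.piece s ⟶ X := biproduct.ι D.piece s ≫ D.iso.inv

/-- The projection to the homogeneous component `X_s`. -/
def π (s : Γ) : X ⟶ D.piece s := D.iso.hom ≫ biproduct.π D.piece s

end Decomposition

variable (Γ) in
/-- A `Γ`-grading by full (replete) subcategories. -/
structure Grading (C : Type u) [Category.{v} C] [Preadditive C] [HasFiniteBiproducts C]
    [MonoidalCategory C] where
  comp : Γ → ObjectProperty C
  isClosedUnderIso : ∀ s, (comp s).IsClosedUnderIsomorphisms
  decomposition : ∀ X : C, Nonempty (Decomposition comp X)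
  hom_eq_zero : ∀ {s t : Γ} {X Y : C}, comp s X → comp t Y → s ≠ t → ∀ f : X ⟶ Y, f = 0
  tensor_mem : ∀ {s t : Γ} {X Y : C}, comp s X → comp t Y → comp (s * t) (X ⊗ Y)

/-- A `(G, Γ)`-crossed action on the monoidal category `C`. The diagrams are those for a strict
category with the associativity and unit isomorphisms of `C` inserted; `action.cast` identifies
`ρ^a(X)` and `ρ^b(X)` for equal group elements `a` and `b`. -/
structure CrossedAction (M : MatchedPair G Γ) (C : Type u) [Category.{v} C] [Preadditive C]
    [HasFiniteBiproducts C] [Linear k C] [MonoidalCategory C] where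
  grading : Grading Γ C
  action : RightAction k G C
  /-- `ρ^g(C_s) = C_{s ◁ g}` -/
  map_comp : ∀ (g : G) (s : Γ),
    (grading.comp s).map (action.functor g) = grading.comp (M.right s g)
  /-- `γ^g_{X,Y}` for `Y` in `C_t` -/
  γ : ∀ (g : G) (X : C) {t : Γ} {Y : C} (_ : grading.comp t Y),
    (action.functor g).obj (X ⊗ Y) ≅
      (action.functor (M.left t g)).obj X ⊗ (action.functor g).obj Y
  γ_natural : ∀ (g : G) {X X' : C} {t : Γ} {Y Y' : C} (hY : grading.comp t Y)
    (hY' : grading.comp t Y') (f : X ⟶ X') (f' : Y ⟶ Y'),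
    (action.functor g).map (f ⊗ₘ f') ≫ (γ g X' hY').hom =
      (γ g X hY).hom ≫ ((action.functor (M.left t g)).map f ⊗ₘ (action.functor g).map f')
  γ₀ : ∀ g : G, (action.functor g).obj (𝟙_ C) ≅ 𝟙_ C
  /-- compatibility of `γ` with associativity -/
  γ_assoc : ∀ (g : G) (X : C) {s t : Γ} {Y Z : C} (hY : grading.comp s Y)
    (hZ : grading.comp t Z),
    (γ g (X ⊗ Y) hZ).hom ≫ (γ (M.left t g) X hY).hom ▷ (action.functor g).obj Z ≫
        (α_ _ _ _).hom =
      (action.functor g).map (α_ X Y Z).hom ≫ (γ g X (grading.tensor_mem hY hZ)).hom ≫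
        (action.cast (M.mul_left s t g) X ⊗ₘ (γ g Y hZ).hom)
  /-- right unit constraint; in a tensor category the unit object always lies in `C_e` -/
  γ_unit_right : ∀ (g : G) (X : C) (h : grading.comp 1 (𝟙_ C)),
    (γ g X h).hom ≫ (action.cast (M.one_left g) X ⊗ₘ (γ₀ g).hom) ≫ (ρ_ _).hom =
      (action.functor g).map (ρ_ X).hom
  /-- left unit constraint -/
  γ_unit_left : ∀ (g : G) {s : Γ} {X : C} (hX : grading.comp s X),
    (γ g (𝟙_ C) hX).hom ≫ (γ₀ (M.left s g)).hom ▷ (action.functor g).obj X ≫ (λ_ _).hom =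
      (action.functor g).map (λ_ X).hom
  /-- compatibility of `γ` with the multiplication of the action -/
  γ_mul : ∀ (g h : G) (X : C) {s : Γ} {Y : C} (hY : grading.comp s Y),
    (action.mul g h).hom.app (X ⊗ Y) ≫ (γ (h * g) X hY).hom =
      (action.functor g).map (γ h X hY).hom ≫
        (γ g ((action.functor (M.left s h)).obj X)
          ((map_comp h s).le _ (ObjectProperty.prop_map_obj _ _ hY))).hom ≫
        (((action.mul (M.left (M.right s h) g) (M.left s h)).hom.app X ≫
          action.cast (M.left_mul s h g).symm X) ⊗ₘ (action.mul g h).hom.app Y)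
  /-- compatibility of `γ₀` with the multiplication of the action -/
  γ₀_mul : ∀ g h : G,
    (action.mul g h).hom.app (𝟙_ C) ≫ (γ₀ (h * g)).hom =
      (action.functor g).map (γ₀ h).hom ≫ (γ₀ g).hom
  /-- compatibility of `γ` with the unit of the action -/
  γ_one : ∀ (X : C) {s : Γ} {Y : C} (hY : grading.comp s Y),
    action.one.hom.app (X ⊗ Y) ≫ (γ 1 X hY).hom =
      (action.one.hom.app X ≫ action.cast (M.left_one s).symm X) ⊗ₘ action.one.hom.app Y
  /-- compatibility of `γ₀` with the unit of the action -/
  γ₀_one : action.one.hom.app (𝟙_ C) ≫ (γ₀ 1).hom = 𝟙 (𝟙_ C)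

namespace CrossedAction

variable {k} {M : MatchedPair G Γ} {C : Type u} [Category.{v} C] [Preadditive C]
  [HasFiniteBiproducts C] [Linear k C] [MonoidalCategory C] (𝒜 : CrossedAction k M C)

/-- The category underlying `C^{(G, Γ)}`: the equivariantization of `C` under `ρ`. -/
abbrev Equivariantization := EquivariantObject 𝒜.action

/-- The restriction `r^g_s : ρ^g(Y_s) ⟶ Y_{s ◁ g}` of `r^g`, for a decomposition of `Y`. -/
def actPiece (B : 𝒜.Equivariantization) (D : Decomposition 𝒜.grading.comp B.obj) (g : G) (s : Γ) :
    (𝒜.action.functor g).obj (D.piece s) ⟶ D.piece (M.right s g) :=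
  (𝒜.action.functor g).map (D.ι s) ≫ B.act g ≫ D.π (M.right s g)

/-- The morphism `ρ^g(X ⊗ Y) ⟶ X ⊗ Y` given on `ρ^g(X ⊗ Y_s)` by `γ^g_{X,Y_s}` followed by
`r^{s ▷ g} ⊗ r'^g_s` and the inclusion of `X ⊗ Y_{s ◁ g}`. -/
def tensorAct (A B : 𝒜.Equivariantization) (D : Decomposition 𝒜.grading.comp B.obj) (g : G) :
    (𝒜.action.functor g).obj (A.obj ⊗ B.obj) ⟶ A.obj ⊗ B.obj :=
  ∑ s : Γ, (𝒜.action.functor g).map (A.obj ◁ D.π s) ≫ (𝒜.γ g A.obj (D.mem s)).hom ≫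
    (A.act (M.left s g) ⊗ₘ 𝒜.actPiece B D g s) ≫ A.obj ◁ D.ι (M.right s g)

/-- A monoidal structure on the equivariantization is the twisted one: the tensor product of
`(X, r)` and `(Y, r')` is `X ⊗ Y` with the action `tensorAct` (for every decomposition of `Y`), the
unit object is the unit object of `C` with the action `γ₀`, and the forgetful functor to `C` is
strict monoidal. -/
structure IsTwistedMonoidal [MonoidalCategory 𝒜.Equivariantization] : Prop where
  tensor_obj : ∀ A B : 𝒜.Equivariantization, (A ⊗ B).obj = A.obj ⊗ B.obj
  tensor_act : ∀ (A B : 𝒜.Equivariantization) (D : Decomposition 𝒜.grading.comp B.obj) (g : G),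
    (A ⊗ B).act g = (𝒜.action.functor g).map (eqToHom (tensor_obj A B)) ≫
      𝒜.tensorAct A B D g ≫ eqToHom (tensor_obj A B).symm
  unit_obj : (𝟙_ 𝒜.Equivariantization).obj = 𝟙_ C
  unit_act : ∀ g : G, (𝟙_ 𝒜.Equivariantization).act g =
    (𝒜.action.functor g).map (eqToHom unit_obj) ≫ (𝒜.γ₀ g).hom ≫ eqToHom unit_obj.symm
  forget_strict : ∃ F : (EquivariantObject.forget 𝒜.action).Monoidal,
    (∀ A B, F.μ A B = eqToHom (tensor_obj A B).symm) ∧ F.ε = eqToHom unit_obj.symm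

variable [Fintype G]

/-- The comonoidal structure `T(X ⊗ Y) ⟶ T(X) ⊗ T(Y)` of `T = ⨁ g, ρ^g`, whose restriction to
`ρ^g(X ⊗ Y_s)` is `γ^g_{X,Y_s}` followed by the inclusion of `ρ^{s ▷ g}(X) ⊗ ρ^g(Y_s)`. -/
def comulApp (X : C) {Y : C} (D : Decomposition 𝒜.grading.comp Y) :
    𝒜.action.monad.obj (X ⊗ Y) ⟶ 𝒜.action.monad.obj X ⊗ 𝒜.action.monad.obj Y :=
  𝒜.action.desc fun g => ∑ s : Γ, (𝒜.action.functor g).map (X ◁ D.π s) ≫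
    (𝒜.γ g X (D.mem s)).hom ≫
      (𝒜.action.incl X (M.left s g) ⊗ₘ
        ((𝒜.action.functor g).map (D.ι s) ≫ 𝒜.action.incl Y g))

/-- The morphism `T(𝟙) ⟶ 𝟙` with components `γ^g_0`. -/
def counitHom : 𝒜.action.monad.obj (𝟙_ C) ⟶ 𝟙_ C :=
  𝒜.action.desc fun g => (𝒜.γ₀ g).hom

end CrossedAction

end Crossed

end CrossedTensor

end

/-! An equivariant object is the same as a module over the monad `T = ⨁ g, ρ^g`, so it is enough to
show that `T` is a Hopf monad and to transport the monoidal category of its modules along this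
equivalence (`RightAction.modulesEquivalence`).

There are no nonzero morphisms between different degrees, so a map out of `T(X ⊗ Y)` may be tested
on `ρ^g(X ⊗ Z)` with `Z` homogeneous. There the comonoidal structure is just `γ^g_{X,Z}` followed by
inclusions (`map_tensor_comul`). This makes it natural and independent of the decomposition, and
turns axioms (a)-(e) into coassociativity, counitality and compatibility with the multiplication and
unit of `T`. Right counitality also needs `𝟙_ C` to have degree `1`, which follows from its
simplicity.

If `Z` has degree `s`, the left fusion operator carries `ρ^g(X ⊗ ρ^h Z)` isomorphically onto `ρ^{(s
◁ h) ▷ g}(X) ⊗ ρ^{hg}(Z)`, and the right one carries `ρ^g(ρ^h X ⊗ Z)` onto `ρ^{h(s ▷ g)}(X) ⊗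
ρ^g(Z)`. Both maps of indices permute `G × G`, so the fusion operators are invertible
(`isIso_to_sum_tensor_sum`).

Over a Hopf monad the fusion operators with values in any module are invertible. The dual of a
module then carries exactly one action for which the evaluation is linear, and the zigzag identity
makes the coevaluation linear: this is rigidity. The other properties of a tensor category pass to
modules because the forgetful functor is faithful, conservative and exact; exactness on the right
holds because `T` preserves colimits. -/

noncomputable section

namespace CrossedTensor

/-! ### Modules over a Hopf monad -/

section HopfModules

open Functor.OplaxMonoidal

variable {C : Type u} [Category.{v} C] [MonoidalCategory C] {T : Monad C}
  [O : T.toFunctor.OplaxMonoidal]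

namespace IsHopfMonad

variable (H : IsHopfMonad T O)

/-- The tensor product of two modules over a bimonad. -/
abbrev tensorAlgebra (A B : T.Algebra) : T.Algebra where
  A := A.A ⊗ B.A
  a := δ T.toFunctor A.A B.A ≫ (A.a ⊗ₘ B.a)
  unit := by
    rw [← assoc, H.unit_tensor, tensorHom_comp_tensorHom, A.unit, B.unit]
    exact id_tensorHom_id _ _
  assoc := by
    rw [← assoc, H.mul_tensor, assoc, assoc, tensorHom_comp_tensorHom, A.assoc, B.assoc,
      ← tensorHom_comp_tensorHom, δ_natural_assoc, Functor.map_comp, assoc]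

/-- The unit object as a module over a bimonad. -/
abbrev unitAlgebra : T.Algebra where
  A := 𝟙_ C
  a := Functor.OplaxMonoidal.η T.toFunctor
  unit := H.unit_unit
  assoc := H.mul_unit

/-- The tensor product of modules over a bimonad. -/
@[reducible]
def algebraStruct : MonoidalCategoryStruct T.Algebra where
  tensorObj A B := H.tensorAlgebra A B
  whiskerLeft A _ _ f :=
    { f := A.A ◁ f.f
      h := by
        rw [← δ_natural_right_assoc, ← id_tensorHom, ← id_tensorHom, tensorHom_comp_tensorHom,
          assoc, tensorHom_comp_tensorHom, f.h, id_comp, comp_id] }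
  whiskerRight f B :=
    { f := f.f ▷ B.A
      h := by
        rw [← δ_natural_left_assoc, ← tensorHom_id, ← tensorHom_id, tensorHom_comp_tensorHom,
          assoc, tensorHom_comp_tensorHom, f.h, id_comp, comp_id] }
  tensorHom f g :=
    { f := f.f ⊗ₘ g.f
      h := by
        rw [← δ_natural_assoc, tensorHom_comp_tensorHom, assoc, tensorHom_comp_tensorHom,
          f.h, g.h] }
  tensorUnit := H.unitAlgebra
  associator A B D := Monad.Algebra.isoMk (α_ A.A B.A D.A) (by
    dsimp only
    have e₁ : (A.a ⊗ₘ δ T.toFunctor B.A D.A ≫ (B.a ⊗ₘ D.a)) =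
        T.obj A.A ◁ δ T.toFunctor B.A D.A ≫ (A.a ⊗ₘ B.a ⊗ₘ D.a) := by
      rw [← id_tensorHom, tensorHom_comp_tensorHom, id_comp]
    have e₂ : (δ T.toFunctor A.A B.A ≫ (A.a ⊗ₘ B.a) ⊗ₘ D.a) =
        δ T.toFunctor A.A B.A ▷ T.obj D.A ≫ ((A.a ⊗ₘ B.a) ⊗ₘ D.a) := by
      rw [← tensorHom_id, tensorHom_comp_tensorHom, id_comp]
    rw [e₁, e₂, assoc, assoc, associator_naturality,
      Functor.OplaxMonoidal.associativity_assoc])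
  leftUnitor A := Monad.Algebra.isoMk (λ_ A.A) (by
    dsimp only
    rw [MonoidalCategory.tensorHom_def, assoc, assoc, leftUnitor_naturality,
      left_unitality_hom_assoc])
  rightUnitor A := Monad.Algebra.isoMk (ρ_ A.A) (by
    dsimp only
    rw [tensorHom_def', assoc, assoc, rightUnitor_naturality, right_unitality_hom_assoc])

/-- The forgetful functor of the modules over a bimonad induces their monoidal structure. -/
def algebraInducing :
    letI := H.algebraStruct
    Monoidal.InducingFunctorData T.forget :=
  letI := H.algebraStruct
  { μIso := fun _ _ => Iso.refl _
    εIso := Iso.refl _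
    whiskerLeft_eq := fun A _ _ f =>
      show A.A ◁ f.f = 𝟙 _ ≫ A.A ◁ f.f ≫ 𝟙 _ by simp
    whiskerRight_eq := fun f B =>
      show f.f ▷ B.A = 𝟙 _ ≫ f.f ▷ B.A ≫ 𝟙 _ by simp
    tensorHom_eq := fun f g =>
      show (f.f ⊗ₘ g.f) = 𝟙 _ ≫ (f.f ⊗ₘ g.f) ≫ 𝟙 _ by simp
    associator_eq := fun A B D =>
      show (α_ A.A B.A D.A).hom = (𝟙 _ ≫ (𝟙 _ ⊗ₘ 𝟙 _)) ≫ (α_ A.A B.A D.A).hom ≫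
        (𝟙 _ ⊗ₘ 𝟙 _) ≫ 𝟙 _ by simp
    leftUnitor_eq := fun A =>
      show (λ_ A.A).hom = (𝟙 _ ≫ (𝟙 _ ⊗ₘ 𝟙 _)) ≫ (λ_ A.A).hom by simp
    rightUnitor_eq := fun A =>
      show (ρ_ A.A).hom = (𝟙 _ ≫ (𝟙 _ ⊗ₘ 𝟙 _)) ≫ (ρ_ A.A).hom by simp }

/-- The monoidal category of modules over a bimonad. -/
@[reducible]
def algebraMonoidal : MonoidalCategory T.Algebra :=
  letI := H.algebraStruct
  Monoidal.induced T.forget H.algebraInducing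

/-- The forgetful functor of the modules over a bimonad is strict monoidal. -/
@[reducible]
def forgetMonoidal :
    letI := H.algebraMonoidal
    T.forget.Monoidal :=
  letI := H.algebraStruct
  Monoidal.fromInducedMonoidal T.forget H.algebraInducing

/-! ### Fusion operators with values in a module. -/

/-- The left fusion operator `T(Y ⊗ X) ⟶ T(Y) ⊗ X` of a module `X`. -/
def leftFusion (Y : C) (A : T.Algebra) : T.obj (Y ⊗ A.A) ⟶ T.obj Y ⊗ A.A :=
  δ T.toFunctor Y A.A ≫ T.obj Y ◁ A.a

/-- The right fusion operator `T(X ⊗ Y) ⟶ X ⊗ T(Y)` of a module `X`. -/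
def rightFusion (A : T.Algebra) (Y : C) : T.obj (A.A ⊗ Y) ⟶ A.A ⊗ T.obj Y :=
  δ T.toFunctor A.A Y ≫ A.a ▷ T.obj Y

lemma leftFusion_naturality_left {Y Y' : C} (f : Y ⟶ Y') (A : T.Algebra) :
    T.map (f ▷ A.A) ≫ leftFusion Y' A = leftFusion Y A ≫ T.map f ▷ A.A := by
  rw [leftFusion, leftFusion, ← δ_natural_left_assoc, assoc, whisker_exchange]

lemma leftFusion_naturality_left_assoc {Y Y' Z : C} (f : Y ⟶ Y') (A : T.Algebra)
    (h : T.obj Y' ⊗ A.A ⟶ Z) :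
    T.map (f ▷ A.A) ≫ leftFusion Y' A ≫ h = leftFusion Y A ≫ T.map f ▷ A.A ≫ h :=
  (reassoc_of% (leftFusion_naturality_left f A)) h

lemma leftFusion_naturality_right (Y : C) {A B : T.Algebra} (f : A ⟶ B) :
    T.map (Y ◁ f.f) ≫ leftFusion Y B = leftFusion Y A ≫ T.obj Y ◁ f.f := by
  rw [leftFusion, leftFusion, ← δ_natural_right_assoc, assoc, ← whiskerLeft_comp, f.h,
    whiskerLeft_comp]

lemma rightFusion_naturality_right (A : T.Algebra) {Y Y' : C} (f : Y ⟶ Y') :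
    T.map (A.A ◁ f) ≫ rightFusion A Y' = rightFusion A Y ≫ A.A ◁ T.map f := by
  rw [rightFusion, rightFusion, ← δ_natural_right_assoc, assoc, whisker_exchange]

lemma rightFusion_naturality_right_assoc (A : T.Algebra) {Y Y' Z : C} (f : Y ⟶ Y')
    (h : A.A ⊗ T.obj Y' ⟶ Z) :
    T.map (A.A ◁ f) ≫ rightFusion A Y' ≫ h = rightFusion A Y ≫ A.A ◁ T.map f ≫ h :=
  (reassoc_of% (rightFusion_naturality_right A f)) h

lemma rightFusion_naturality_left {A B : T.Algebra} (f : A ⟶ B) (Y : C) :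
    T.map (f.f ▷ Y) ≫ rightFusion B Y = rightFusion A Y ≫ f.f ▷ T.obj Y := by
  rw [rightFusion, rightFusion, ← δ_natural_left_assoc, assoc, ← comp_whiskerRight, f.h,
    comp_whiskerRight]

/-- The free module `T(X)`. -/
abbrev freeAlgebra (X : C) : T.Algebra where
  A := T.obj X
  a := T.μ.app X
  unit := T.left_unit X
  assoc := (T.assoc X).symm

/-- The structure morphism `T(X) ⟶ X` of a module as a morphism of modules. -/
def structureMap (A : T.Algebra) : freeAlgebra A.A ⟶ A where
  f := A.a
  h := A.assoc.symm

/-- The morphism of free modules `T(f)`. -/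
def freeMap {X Y : C} (f : X ⟶ Y) : freeAlgebra (T := T) X ⟶ freeAlgebra Y where
  f := T.map f
  h := T.μ.naturality f

/-- The Hopf axiom is the case of a free module. A general module is the split coequalizer of
`T(T(A)) ⇉ T(A)`, and naturality of the fusion operator descends invertibility along the structure
map. -/
lemma isIso_leftFusion (H : IsHopfMonad T O) (Y : C) (A : T.Algebra) :
    IsIso (leftFusion Y A) := by
  have hfree : ∀ X : C, IsIso (leftFusion Y (freeAlgebra X)) := fun X => H.left_fusion Y X
  have n₁ : T.map (Y ◁ A.a) ≫ leftFusion Y A =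
      leftFusion Y (freeAlgebra A.A) ≫ T.obj Y ◁ A.a :=
    leftFusion_naturality_right Y (structureMap A)
  have n₂ : T.map (Y ◁ T.map A.a) ≫ leftFusion Y (freeAlgebra A.A) =
      leftFusion Y (freeAlgebra (T.obj A.A)) ≫ T.obj Y ◁ T.map A.a :=
    leftFusion_naturality_right Y (freeMap A.a)
  have n₃ : T.map (Y ◁ T.μ.app A.A) ≫ leftFusion Y (freeAlgebra A.A) =
      leftFusion Y (freeAlgebra (T.obj A.A)) ≫ T.obj Y ◁ T.μ.app A.A :=
    leftFusion_naturality_right Y (structureMap (freeAlgebra A.A))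
  -- Pass to the free module by the unit, invert there, and come back by the action. One composite
  -- is immediate from naturality; the other is checked after the split epimorphism `T(Y ◁ a)`.
  refine ⟨T.obj Y ◁ T.η.app A.A ≫ inv (leftFusion Y (freeAlgebra A.A)) ≫ T.map (Y ◁ A.a), ?_, ?_⟩
  · have hη : A.a ≫ T.η.app A.A = T.η.app (T.obj A.A) ≫ T.map A.a := T.η.naturality A.a
    have : IsSplitEpi (T.map (Y ◁ A.a)) := ⟨⟨⟨T.map (Y ◁ T.η.app A.A), by
      rw [← T.map_comp, ← whiskerLeft_comp, A.unit, whiskerLeft_id, T.map_id]⟩⟩⟩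
    rw [← cancel_epi (T.map (Y ◁ A.a)), reassoc_of% n₁, ← whiskerLeft_comp_assoc, hη, comp_id]
    have n₂' : T.obj Y ◁ T.map A.a ≫ inv (leftFusion Y (freeAlgebra A.A)) =
        inv (leftFusion Y (freeAlgebra (T.obj A.A))) ≫ T.map (Y ◁ T.map A.a) := by
      rw [IsIso.comp_inv_eq, assoc, n₂, IsIso.inv_hom_id_assoc]
    have n₃' : inv (leftFusion Y (freeAlgebra (T.obj A.A))) ≫ T.map (Y ◁ T.μ.app A.A) =
        T.obj Y ◁ T.μ.app A.A ≫ inv (leftFusion Y (freeAlgebra A.A)) := by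
      rw [IsIso.eq_comp_inv, assoc, n₃, IsIso.inv_hom_id_assoc]
    rw [whiskerLeft_comp_assoc, reassoc_of% n₂', ← T.map_comp, ← whiskerLeft_comp, ← A.assoc,
      whiskerLeft_comp, T.map_comp, reassoc_of% n₃', ← whiskerLeft_comp_assoc, T.left_unit]
    dsimp only [Functor.id_obj]
    rw [whiskerLeft_id, id_comp, IsIso.hom_inv_id_assoc]
  · rw [assoc, assoc, n₁, IsIso.inv_hom_id_assoc, ← whiskerLeft_comp, A.unit, whiskerLeft_id]

lemma isIso_rightFusion (H : IsHopfMonad T O) (A : T.Algebra) (Y : C) :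
    IsIso (rightFusion A Y) := by
  have hfree : ∀ X : C, IsIso (rightFusion (freeAlgebra X) Y) := fun X => H.right_fusion X Y
  have n₁ : T.map (A.a ▷ Y) ≫ rightFusion A Y =
      rightFusion (freeAlgebra A.A) Y ≫ A.a ▷ T.obj Y :=
    rightFusion_naturality_left (structureMap A) Y
  have n₂ : T.map (T.map A.a ▷ Y) ≫ rightFusion (freeAlgebra A.A) Y =
      rightFusion (freeAlgebra (T.obj A.A)) Y ≫ T.map A.a ▷ T.obj Y :=
    rightFusion_naturality_left (freeMap A.a) Y
  have n₃ : T.map (T.μ.app A.A ▷ Y) ≫ rightFusion (freeAlgebra A.A) Y =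
      rightFusion (freeAlgebra (T.obj A.A)) Y ≫ T.μ.app A.A ▷ T.obj Y :=
    rightFusion_naturality_left (structureMap (freeAlgebra A.A)) Y
  refine ⟨T.η.app A.A ▷ T.obj Y ≫ inv (rightFusion (freeAlgebra A.A) Y) ≫ T.map (A.a ▷ Y), ?_, ?_⟩
  · have hη : A.a ≫ T.η.app A.A = T.η.app (T.obj A.A) ≫ T.map A.a := T.η.naturality A.a
    have : IsSplitEpi (T.map (A.a ▷ Y)) := ⟨⟨⟨T.map (T.η.app A.A ▷ Y), by
      rw [← T.map_comp, ← comp_whiskerRight, A.unit]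
      exact (congrArg _ (id_whiskerRight _ _)).trans (T.map_id _)⟩⟩⟩
    rw [← cancel_epi (T.map (A.a ▷ Y)), reassoc_of% n₁, ← comp_whiskerRight_assoc, hη, comp_id]
    have n₂' : T.map A.a ▷ T.obj Y ≫ inv (rightFusion (freeAlgebra A.A) Y) =
        inv (rightFusion (freeAlgebra (T.obj A.A)) Y) ≫ T.map (T.map A.a ▷ Y) := by
      rw [IsIso.comp_inv_eq, assoc, n₂, IsIso.inv_hom_id_assoc]
    have n₃' : inv (rightFusion (freeAlgebra (T.obj A.A)) Y) ≫ T.map (T.μ.app A.A ▷ Y) =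
        T.μ.app A.A ▷ T.obj Y ≫ inv (rightFusion (freeAlgebra A.A) Y) := by
      rw [IsIso.eq_comp_inv, assoc, n₃, IsIso.inv_hom_id_assoc]
    rw [comp_whiskerRight_assoc, reassoc_of% n₂', ← T.map_comp, ← comp_whiskerRight, ← A.assoc,
      comp_whiskerRight, T.map_comp, reassoc_of% n₃', ← comp_whiskerRight_assoc, T.left_unit]
    dsimp only [Functor.id_obj]
    rw [id_whiskerRight, id_comp, IsIso.hom_inv_id_assoc]
  · rw [assoc, assoc, n₁, IsIso.inv_hom_id_assoc, ← comp_whiskerRight, A.unit]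
    exact id_whiskerRight _ _

lemma unit_leftFusion (H : IsHopfMonad T O) (Y : C) (A : T.Algebra) :
    T.η.app (Y ⊗ A.A) ≫ leftFusion Y A = T.η.app Y ▷ A.A := by
  rw [leftFusion, ← assoc, H.unit_tensor, ← id_tensorHom, tensorHom_comp_tensorHom, A.unit,
    comp_id]
  exact tensorHom_id _ _

lemma unit_rightFusion (H : IsHopfMonad T O) (A : T.Algebra) (Y : C) :
    T.η.app (A.A ⊗ Y) ≫ rightFusion A Y = A.A ◁ T.η.app Y := by
  rw [rightFusion, ← assoc, H.unit_tensor, ← tensorHom_id, tensorHom_comp_tensorHom, A.unit,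
    comp_id]
  exact id_tensorHom _ _

/-- Comultiplicativity of `μ` and associativity of the action combine here. Together with
`unit_leftFusion`, this gives the module axioms of the dual. -/
lemma mul_leftFusion (H : IsHopfMonad T O) (Y : C) (A : T.Algebra) :
    T.μ.app (Y ⊗ A.A) ≫ leftFusion Y A =
      T.map (leftFusion Y A) ≫ leftFusion (T.obj Y) A ≫ T.μ.app Y ▷ A.A := by
  rw [leftFusion, ← assoc, H.mul_tensor, leftFusion, T.map_comp, assoc, assoc, assoc, assoc,
    ← δ_natural_right_assoc, ← MonoidalCategory.tensorHom_def', ← id_tensorHom, ← id_tensorHom,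
    tensorHom_comp_tensorHom, tensorHom_comp_tensorHom, A.assoc, id_comp, comp_id]

lemma mul_rightFusion (H : IsHopfMonad T O) (A : T.Algebra) (Y : C) :
    T.μ.app (A.A ⊗ Y) ≫ rightFusion A Y =
      T.map (rightFusion A Y) ≫ rightFusion A (T.obj Y) ≫ A.A ◁ T.μ.app Y := by
  rw [rightFusion, ← assoc, H.mul_tensor, rightFusion, T.map_comp, assoc, assoc, assoc, assoc,
    ← δ_natural_left_assoc, ← MonoidalCategory.tensorHom_def, ← tensorHom_id, ← tensorHom_id,
    tensorHom_comp_tensorHom, tensorHom_comp_tensorHom, A.assoc, id_comp, comp_id]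

/-! ### Duality pairings determine morphisms into a dual. -/

/-- Up to a unit isomorphism, `f ▷ X ≫ ε_ X Y` is the image of `f` under the duality bijection
between maps `Z ⟶ Y` and maps `Z ⊗ X ⟶ 𝟙_ C`. `exists_pairing_right` is the surjectivity of the same
bijection. -/
lemma pairing_right_ext {X Y Z : C} [ExactPairing X Y] {f g : Z ⟶ Y}
    (h : f ▷ X ≫ ε_ X Y = g ▷ X ≫ ε_ X Y) : f = g := by
  have := (tensorRightHomEquiv Z X Y (𝟙_ C)).symm.injective
    (a₁ := f ≫ (λ_ Y).inv) (a₂ := g ≫ (λ_ Y).inv) (by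
      rw [tensorRightHomEquiv_symm_naturality, tensorRightHomEquiv_symm_naturality]
      have e : (tensorRightHomEquiv Y X Y (𝟙_ C)).symm (λ_ Y).inv = ε_ X Y := by
        simp [tensorRightHomEquiv, ← unitors_equal]
      rw [e, h])
  simpa using this

lemma pairing_left_ext {X Y Z : C} [ExactPairing X Y] {f g : Z ⟶ X}
    (h : Y ◁ f ≫ ε_ X Y = Y ◁ g ≫ ε_ X Y) : f = g := by
  have := (tensorLeftHomEquiv Z X Y (𝟙_ C)).symm.injective
    (a₁ := f ≫ (ρ_ X).inv) (a₂ := g ≫ (ρ_ X).inv) (by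
      rw [tensorLeftHomEquiv_symm_naturality, tensorLeftHomEquiv_symm_naturality]
      have e : (tensorLeftHomEquiv X X Y (𝟙_ C)).symm (ρ_ X).inv = ε_ X Y := by
        simp [tensorLeftHomEquiv, unitors_equal]
      rw [e, h])
  simpa using this

lemma exists_pairing_right {X Y Z : C} [ExactPairing X Y] (p : Z ⊗ X ⟶ 𝟙_ C) :
    ∃ f : Z ⟶ Y, f ▷ X ≫ ε_ X Y = p := by
  refine ⟨tensorRightHomEquiv Z X Y (𝟙_ C) p ≫ (λ_ Y).hom, ?_⟩
  rw [← (tensorRightHomEquiv Z X Y (𝟙_ C)).symm_apply_apply p]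
  generalize tensorRightHomEquiv Z X Y (𝟙_ C) p = q
  rw [Equiv.apply_symm_apply]
  simp [tensorRightHomEquiv, ← unitors_equal]

lemma exists_pairing_left {X Y Z : C} [ExactPairing X Y] (p : Y ⊗ Z ⟶ 𝟙_ C) :
    ∃ f : Z ⟶ X, Y ◁ f ≫ ε_ X Y = p := by
  refine ⟨tensorLeftHomEquiv Z X Y (𝟙_ C) p ≫ (ρ_ X).hom, ?_⟩
  rw [← (tensorLeftHomEquiv Z X Y (𝟙_ C)).symm_apply_apply p]
  generalize tensorLeftHomEquiv Z X Y (𝟙_ C) p = q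
  rw [Equiv.apply_symm_apply]
  simp [tensorLeftHomEquiv, unitors_equal]

/-! ### Duals of modules over a Hopf monad. -/

section Duals

variable (H : IsHopfMonad T O) (A : T.Algebra)

/-- The action of `T` on the right dual of a module. -/
def rightDualAct (Y : C) [ExactPairing A.A Y] : T.obj Y ⟶ Y :=
  haveI := H.isIso_leftFusion Y A
  (exists_pairing_right (X := A.A) (Y := Y) (inv (leftFusion Y A) ≫ T.map (ε_ A.A Y) ≫
    Functor.OplaxMonoidal.η T.toFunctor)).choose

/-- This says that the evaluation is linear, with the action on the tensor product factored through
the fusion operator. As that operator is invertible and the pairing nondegenerate, it characterizes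
the dual action. -/
lemma rightDualAct_evaluation (Y : C) [ExactPairing A.A Y] :
    leftFusion Y A ≫ H.rightDualAct A Y ▷ A.A ≫ ε_ A.A Y =
      T.map (ε_ A.A Y) ≫ Functor.OplaxMonoidal.η T.toFunctor := by
  have := H.isIso_leftFusion Y A
  rw [rightDualAct, (exists_pairing_right (X := A.A) (Y := Y) (inv (leftFusion Y A) ≫
    T.map (ε_ A.A Y) ≫ Functor.OplaxMonoidal.η T.toFunctor)).choose_spec,
    IsIso.hom_inv_id_assoc]

/-- The right dual of a module over a Hopf monad. -/
abbrev rightDualAlgebra (Y : C) [ExactPairing A.A Y] : T.Algebra where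
  A := Y
  a := H.rightDualAct A Y
  unit := by
    refine pairing_right_ext (X := A.A) ?_
    rw [comp_whiskerRight, assoc, ← H.unit_leftFusion, assoc, H.rightDualAct_evaluation]
    have := T.η.naturality (ε_ A.A Y)
    rw [← reassoc_of% this, H.unit_unit]
    dsimp only [Functor.id_obj, Functor.id_map]
    rw [comp_id, id_whiskerRight, id_comp]
  assoc := by
    have := H.isIso_leftFusion Y A
    have := H.isIso_leftFusion (T.obj Y) A
    refine pairing_right_ext (X := A.A) ?_
    -- After pairing with `A` and composing with two invertible fusion operators, both sides of
    -- associativity reduce to `ε` followed by the counit on `T(T(Y ⊗ A))`.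
    rw [← cancel_epi (leftFusion (T.obj Y) A), ← cancel_epi (T.map (leftFusion Y A)),
      comp_whiskerRight, comp_whiskerRight, assoc, assoc, ← leftFusion_naturality_left_assoc,
      H.rightDualAct_evaluation]
    have e₁ := H.mul_leftFusion Y A
    rw [← reassoc_of% e₁, H.rightDualAct_evaluation, ← T.map_comp_assoc, ← T.map_comp_assoc,
      assoc, H.rightDualAct_evaluation, T.map_comp, assoc, ← H.mul_unit]
    have e₂ := T.μ.naturality (ε_ A.A Y)
    simp only [← assoc]
    exact (e₂ =≫ Functor.OplaxMonoidal.η T.toFunctor).symm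

lemma tensorAlgebra_a_left (A B : T.Algebra) :
    (H.tensorAlgebra A B).a = leftFusion A.A B ≫ A.a ▷ B.A := by
  rw [leftFusion, assoc, ← tensorHom_def']

lemma tensorAlgebra_a_right (A B : T.Algebra) :
    (H.tensorAlgebra A B).a = rightFusion A B.A ≫ A.A ◁ B.a := by
  rw [rightFusion, assoc, ← MonoidalCategory.tensorHom_def]

/-- The evaluation at a module as a morphism of modules. -/
def rightDualEval (Y : C) [ExactPairing A.A Y] :
    H.tensorAlgebra (H.rightDualAlgebra A Y) A ⟶ H.unitAlgebra where
  f := ε_ A.A Y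
  h := by
    rw [tensorAlgebra_a_left, assoc]
    exact (H.rightDualAct_evaluation A Y).symm

/-- Under duality, linearity of the coevaluation becomes an equation of maps into `A`. There the
zigzag identity replaces the coevaluation by the left unitor, and both the unitor and the
contraction with `ε` are already known to be linear. -/
lemma coevaluation_rightDualAct (Y : C) [ExactPairing A.A Y] :
    T.map (η_ A.A Y) ≫ (H.tensorAlgebra A (H.rightDualAlgebra A Y)).a =
      Functor.OplaxMonoidal.η T.toFunctor ≫ η_ A.A Y := by
  let := H.algebraMonoidal
  have := H.isIso_leftFusion (𝟙_ C) A
  have hk : T.map ((α_ A.A Y A.A).hom ≫ A.A ◁ ε_ A.A Y ≫ (ρ_ A.A).hom) ≫ A.a =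
      (H.tensorAlgebra (H.tensorAlgebra A (H.rightDualAlgebra A Y)) A).a ≫
        (α_ A.A Y A.A).hom ≫ A.A ◁ ε_ A.A Y ≫ (ρ_ A.A).hom :=
    ((α_ A (H.rightDualAlgebra A Y) A).hom ≫ A ◁ H.rightDualEval A Y ≫ (ρ_ A).hom).h
  have hl : T.map (λ_ A.A).hom ≫ A.a = (H.tensorAlgebra H.unitAlgebra A).a ≫ (λ_ A.A).hom :=
    (λ_ A).hom.h
  have hz : η_ A.A Y ▷ A.A ≫ (α_ A.A Y A.A).hom ≫ A.A ◁ ε_ A.A Y ≫ (ρ_ A.A).hom =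
      (λ_ A.A).hom := by
    rw [ExactPairing.evaluation_coevaluation_assoc, Iso.inv_hom_id, comp_id]
  rw [tensorAlgebra_a_left, assoc] at hk hl
  -- The action on `A ⊗ Y` enters only through the linearity of the contraction, so its formula can
  -- be forgotten.
  generalize (H.tensorAlgebra A (H.rightDualAlgebra A Y)).a = b at hk ⊢
  refine (tensorRightHomEquiv _ A.A Y A.A).symm.injective ?_
  change _ ▷ A.A ≫ (α_ A.A Y A.A).hom ≫ A.A ◁ ε_ A.A Y ≫ (ρ_ A.A).hom =
    _ ▷ A.A ≫ (α_ A.A Y A.A).hom ≫ A.A ◁ ε_ A.A Y ≫ (ρ_ A.A).hom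
  rw [← cancel_epi (leftFusion (𝟙_ C) A), comp_whiskerRight, comp_whiskerRight, assoc, assoc,
    hz, ← leftFusion_naturality_left_assoc, ← hl, ← hk, ← T.map_comp_assoc, hz]

/-- The right dual of a module is its right dual in the monoidal category of modules. -/
@[reducible]
def rightDualPairing (Y : C) [ExactPairing A.A Y] :
    letI := H.algebraMonoidal
    ExactPairing A (H.rightDualAlgebra A Y) :=
  letI := H.algebraMonoidal
  { coevaluation' :=
      { f := η_ A.A Y
        h := H.coevaluation_rightDualAct A Y }
    evaluation' := H.rightDualEval A Y
    coevaluation_evaluation' :=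
      Monad.Algebra.Hom.ext' _ _ _ _ (ExactPairing.coevaluation_evaluation A.A Y)
    evaluation_coevaluation' :=
      Monad.Algebra.Hom.ext' _ _ _ _ (ExactPairing.evaluation_coevaluation A.A Y) }

/-- The action of `T` on the left dual of a module. -/
def leftDualAct (Y : C) [ExactPairing Y A.A] : T.obj Y ⟶ Y :=
  haveI := H.isIso_rightFusion A Y
  (exists_pairing_left (X := Y) (Y := A.A) (inv (rightFusion A Y) ≫ T.map (ε_ Y A.A) ≫
    Functor.OplaxMonoidal.η T.toFunctor)).choose

lemma leftDualAct_evaluation (Y : C) [ExactPairing Y A.A] :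
    rightFusion A Y ≫ A.A ◁ H.leftDualAct A Y ≫ ε_ Y A.A =
      T.map (ε_ Y A.A) ≫ Functor.OplaxMonoidal.η T.toFunctor := by
  have := H.isIso_rightFusion A Y
  rw [leftDualAct, (exists_pairing_left (X := Y) (Y := A.A) (inv (rightFusion A Y) ≫
    T.map (ε_ Y A.A) ≫ Functor.OplaxMonoidal.η T.toFunctor)).choose_spec,
    IsIso.hom_inv_id_assoc]

/-- The left dual of a module over a Hopf monad. -/
abbrev leftDualAlgebra (Y : C) [ExactPairing Y A.A] : T.Algebra where
  A := Y
  a := H.leftDualAct A Y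
  unit := by
    refine pairing_left_ext (Y := A.A) ?_
    rw [whiskerLeft_comp, assoc, ← H.unit_rightFusion, assoc, H.leftDualAct_evaluation]
    have := T.η.naturality (ε_ Y A.A)
    rw [← reassoc_of% this, H.unit_unit]
    dsimp only [Functor.id_obj, Functor.id_map]
    rw [comp_id, whiskerLeft_id, id_comp]
  assoc := by
    have := H.isIso_rightFusion A Y
    have := H.isIso_rightFusion A (T.obj Y)
    refine pairing_left_ext (Y := A.A) ?_
    rw [← cancel_epi (rightFusion A (T.obj Y)), ← cancel_epi (T.map (rightFusion A Y)),
      whiskerLeft_comp, whiskerLeft_comp, assoc, assoc, ← rightFusion_naturality_right_assoc,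
      H.leftDualAct_evaluation]
    have e₁ := H.mul_rightFusion A Y
    rw [← reassoc_of% e₁, H.leftDualAct_evaluation, ← T.map_comp_assoc, ← T.map_comp_assoc,
      assoc, H.leftDualAct_evaluation, T.map_comp, assoc, ← H.mul_unit]
    have e₂ := T.μ.naturality (ε_ Y A.A)
    simp only [← assoc]
    exact (e₂ =≫ Functor.OplaxMonoidal.η T.toFunctor).symm

/-- The evaluation at a module as a morphism of modules. -/
def leftDualEval (Y : C) [ExactPairing Y A.A] :
    H.tensorAlgebra A (H.leftDualAlgebra A Y) ⟶ H.unitAlgebra where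
  f := ε_ Y A.A
  h := by
    rw [tensorAlgebra_a_right, assoc]
    exact (H.leftDualAct_evaluation A Y).symm

/-- Mirror image of `coevaluation_rightDualAct`, with right fusion and the other zigzag identity. -/
lemma coevaluation_leftDualAct (Y : C) [ExactPairing Y A.A] :
    T.map (η_ Y A.A) ≫ (H.tensorAlgebra (H.leftDualAlgebra A Y) A).a =
      Functor.OplaxMonoidal.η T.toFunctor ≫ η_ Y A.A := by
  let := H.algebraMonoidal
  have := H.isIso_rightFusion A (𝟙_ C)
  have hk : T.map ((α_ A.A Y A.A).inv ≫ ε_ Y A.A ▷ A.A ≫ (λ_ A.A).hom) ≫ A.a =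
      (H.tensorAlgebra A (H.tensorAlgebra (H.leftDualAlgebra A Y) A)).a ≫
        (α_ A.A Y A.A).inv ≫ ε_ Y A.A ▷ A.A ≫ (λ_ A.A).hom :=
    ((α_ A (H.leftDualAlgebra A Y) A).inv ≫ H.leftDualEval A Y ▷ A ≫ (λ_ A).hom).h
  have hl : T.map (ρ_ A.A).hom ≫ A.a = (H.tensorAlgebra A H.unitAlgebra).a ≫ (ρ_ A.A).hom :=
    (ρ_ A).hom.h
  have hz : A.A ◁ η_ Y A.A ≫ (α_ A.A Y A.A).inv ≫ ε_ Y A.A ▷ A.A ≫ (λ_ A.A).hom =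
      (ρ_ A.A).hom := by
    rw [ExactPairing.coevaluation_evaluation_assoc, Iso.inv_hom_id, comp_id]
  rw [tensorAlgebra_a_right, assoc] at hk hl
  generalize (H.tensorAlgebra (H.leftDualAlgebra A Y) A).a = b at hk ⊢
  refine (tensorLeftHomEquiv _ Y A.A A.A).symm.injective ?_
  change A.A ◁ _ ≫ (α_ A.A Y A.A).inv ≫ ε_ Y A.A ▷ A.A ≫ (λ_ A.A).hom =
    A.A ◁ _ ≫ (α_ A.A Y A.A).inv ≫ ε_ Y A.A ▷ A.A ≫ (λ_ A.A).hom
  rw [← cancel_epi (rightFusion A (𝟙_ C)), whiskerLeft_comp, whiskerLeft_comp, assoc, assoc,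
    hz, ← rightFusion_naturality_right_assoc, ← hl, ← hk, ← T.map_comp_assoc, hz]

/-- The left dual of a module is its left dual in the monoidal category of modules. -/
@[reducible]
def leftDualPairing (Y : C) [ExactPairing Y A.A] :
    letI := H.algebraMonoidal
    ExactPairing (H.leftDualAlgebra A Y) A :=
  letI := H.algebraMonoidal
  { coevaluation' :=
      { f := η_ Y A.A
        h := H.coevaluation_leftDualAct A Y }
    evaluation' := H.leftDualEval A Y
    coevaluation_evaluation' :=
      Monad.Algebra.Hom.ext' _ _ _ _ (ExactPairing.coevaluation_evaluation Y A.A)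
    evaluation_coevaluation' :=
      Monad.Algebra.Hom.ext' _ _ _ _ (ExactPairing.evaluation_coevaluation Y A.A) }

/-- The modules over a Hopf monad on a rigid category form a rigid category. -/
@[reducible]
def algebraRigid [RigidCategory C] :
    letI := H.algebraMonoidal
    RigidCategory T.Algebra :=
  letI := H.algebraMonoidal
  { rightDual := fun A =>
      { rightDual := H.rightDualAlgebra A (A.A)ᘁ
        exact := H.rightDualPairing A (A.A)ᘁ }
    leftDual := fun A =>
      { leftDual := H.leftDualAlgebra A (ᘁ(A.A))
        exact := H.leftDualPairing A (ᘁ(A.A)) } }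

end Duals

end IsHopfMonad

end HopfModules

/-! ### Homogeneous components -/

section Homogeneous

variable {Γ : Type*} [Fintype Γ] {C : Type u} [Category.{v} C] [Preadditive C]
  [HasFiniteBiproducts C]

lemma Decomposition.ι_π_self {comp : Γ → ObjectProperty C} {X : C} (D : Decomposition comp X)
    (s : Γ) : D.ι s ≫ D.π s = 𝟙 _ := by
  simp [Decomposition.ι, Decomposition.π]

lemma Decomposition.sum_π_ι {comp : Γ → ObjectProperty C} {X : C} (D : Decomposition comp X) :
    ∑ s, D.π s ≫ D.ι s = 𝟙 X := by
  have h : ∀ s, D.π s ≫ D.ι s =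
      D.iso.hom ≫ (biproduct.π D.piece s ≫ biproduct.ι D.piece s) ≫ D.iso.inv := fun s => by
    simp [Decomposition.ι, Decomposition.π]
  simp only [h]
  rw [← Preadditive.comp_sum, ← Preadditive.sum_comp]
  have total : ∑ s, biproduct.π D.piece s ≫ biproduct.ι D.piece s = 𝟙 _ := by
    refine biproduct.hom_ext' _ _ fun s => ?_
    rw [Preadditive.comp_sum, Finset.sum_eq_single s, biproduct.ι_π_self_assoc, comp_id]
    · intro t _ ht
      rw [biproduct.ι_π_ne_assoc _ ht.symm, zero_comp]
    · simp
  rw [total, id_comp, Iso.hom_inv_id]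

variable [Group Γ] [MonoidalCategory C] (𝒢 : Grading Γ C)

/-- All components of `f` in degrees other than `s` vanish, so `f` factors through the piece of
degree `s`. -/
lemma Grading.comp_π_ι {s : Γ} {Y Z : C} (hZ : 𝒢.comp s Z) (D : Decomposition 𝒢.comp Y)
    (f : Z ⟶ Y) : f ≫ D.π s ≫ D.ι s = f := by
  conv_rhs => rw [← comp_id f, ← D.sum_π_ι, Preadditive.comp_sum]
  rw [Finset.sum_eq_single s]
  · intro t _ ht
    rw [← assoc, 𝒢.hom_eq_zero hZ (D.mem t) ht.symm (f ≫ D.π t), zero_comp]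
  · simp

/-- The identity of `F(Y)` factors as a sum through homogeneous pieces. Testing on all maps from
homogeneous objects avoids fixing a decomposition. -/
lemma Grading.map_hom_ext {E : Type*} [Category E] [Preadditive E] (F : C ⥤ E) [F.Additive]
    {Y : C} {W : E} {a b : F.obj Y ⟶ W}
    (h : ∀ (s : Γ) (Z : C) (_ : 𝒢.comp s Z) (f : Z ⟶ Y), F.map f ≫ a = F.map f ≫ b) : a = b := by
  obtain ⟨D⟩ := 𝒢.decomposition Y
  have e : 𝟙 (F.obj Y) = ∑ s, F.map (D.π s) ≫ F.map (D.ι s) := by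
    rw [← F.map_id, ← D.sum_π_ι, F.map_sum]
    simp only [F.map_comp]
  rw [← id_comp a, ← id_comp b, e, Preadditive.sum_comp, Preadditive.sum_comp]
  simp only [assoc, h _ _ (D.mem _)]

/-- Some homogeneous component of the unit is nonzero; it is a direct summand of a simple object,
hence everything. Then `𝟙 ⊗ 𝟙 ≅ 𝟙` forces its degree `s` to satisfy `s * s = s`. -/
lemma Grading.comp_one_unit [Simple (𝟙_ C)] : 𝒢.comp 1 (𝟙_ C) := by
  obtain ⟨D⟩ := 𝒢.decomposition (𝟙_ C)
  have : ∃ s, D.ι s ≠ 0 := by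
    by_contra! h
    refine id_nonzero (𝟙_ C) ?_
    rw [← D.sum_π_ι]
    simp [h]
  obtain ⟨s, hs⟩ := this
  have : IsSplitMono (D.ι s) := ⟨⟨⟨D.π s, D.ι_π_self s⟩⟩⟩
  have : IsIso (D.ι s) := isIso_of_mono_of_nonzero hs
  have h₁ : 𝒢.comp s (𝟙_ C) := (𝒢.isClosedUnderIso s).of_iso (asIso (D.ι s)) (D.mem s)
  have h₂ := 𝒢.tensor_mem h₁ h₁
  obtain rfl : s = 1 := by
    by_contra hne
    refine id_nonzero (𝟙_ C) ?_
    have := 𝒢.hom_eq_zero h₂ h₁ (fun h => hne (by simpa using h)) (λ_ (𝟙_ C)).hom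
    rw [← (λ_ (𝟙_ C)).inv_hom_id, this, comp_zero]
  exact h₁

end Homogeneous

/-! ### The comonoidal structure of the monad of a crossed action -/

lemma RightAction.cast_incl {k : Type w} [Field k] {G : Type*} [Group G] [Fintype G]
    {C : Type u} [Category.{v} C] [Preadditive C] [HasFiniteBiproducts C] [Linear k C]
    (ρ : RightAction k G C) (X : C) {a b : G} (h : a = b) :
    ρ.cast h X ≫ ρ.incl X b = ρ.incl X a :=
  ρ.eqToHom_incl X h _

namespace CrossedAction

variable {k : Type w} [Field k] {G Γ : Type*} [Group G] [Group Γ] [Fintype G] [Fintype Γ]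
  {M : MatchedPair G Γ} {C : Type u} [Category.{v} C] [Preadditive C]
  [HasFiniteBiproducts C] [Linear k C] [MonoidalCategory C]
  (𝒜 : CrossedAction k M C)

/-- The counit `T(𝟙) ⟶ 𝟙`. -/
def counit : 𝒜.action.sumFunctor.obj (𝟙_ C) ⟶ 𝟙_ C :=
  𝒜.action.desc fun g => (𝒜.γ₀ g).hom

lemma mulApp_counit :
    𝒜.action.mulApp (𝟙_ C) ≫ 𝒜.counit = 𝒜.action.sumFunctor.map 𝒜.counit ≫ 𝒜.counit := by
  refine 𝒜.action.sum_hom_ext fun g => 𝒜.action.map_sum_hom_ext _ fun h => ?_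
  have hm := 𝒜.action.incl_mulApp (𝟙_ C) g h
  rw [reassoc_of% hm, ← assoc (𝒜.action.incl _ g), 𝒜.action.incl_map, assoc, counit,
    𝒜.action.incl_desc, 𝒜.action.incl_desc, ← Functor.map_comp_assoc, 𝒜.action.incl_desc,
    𝒜.γ₀_mul]

lemma unitApp_counit : 𝒜.action.unitApp (𝟙_ C) ≫ 𝒜.counit = 𝟙 _ := by
  rw [RightAction.unitApp, assoc, counit, 𝒜.action.incl_desc]
  exact 𝒜.γ₀_one

lemma mulApp_naturality {X Y : C} (f : X ⟶ Y) :
    𝒜.action.sumFunctor.map (𝒜.action.sumFunctor.map f) ≫ 𝒜.action.mulApp Y =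
      𝒜.action.mulApp X ≫ 𝒜.action.sumFunctor.map f :=
  𝒜.action.monad.μ.naturality f

variable [MonoidalPreadditive C]

/-- The comultiplication `T(X ⊗ Y) ⟶ T(X) ⊗ T(Y)`, from a decomposition of `Y`. -/
def comulOf (X : C) {Y : C} (D : Decomposition 𝒜.grading.comp Y) :
    𝒜.action.sumFunctor.obj (X ⊗ Y) ⟶
      𝒜.action.sumFunctor.obj X ⊗ 𝒜.action.sumFunctor.obj Y :=
  𝒜.action.desc fun g => ∑ s : Γ, (𝒜.action.functor g).map (X ◁ D.π s) ≫
    (𝒜.γ g X (D.mem s)).hom ≫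
      (𝒜.action.incl X (M.left s g) ⊗ₘ
        ((𝒜.action.functor g).map (D.ι s) ≫ 𝒜.action.incl Y g))

/-- The comultiplication `T(X ⊗ Y) ⟶ T(X) ⊗ T(Y)`. -/
def comul (X Y : C) : 𝒜.action.sumFunctor.obj (X ⊗ Y) ⟶
    𝒜.action.sumFunctor.obj X ⊗ 𝒜.action.sumFunctor.obj Y :=
  𝒜.comulOf X (𝒜.grading.decomposition Y).some

/-- Only the summand of degree `s` survives, and naturality of `γ` then removes the decomposition
from the result. Identities for the comultiplication are verified through this formula. -/
lemma map_tensor_comulOf (g : G) {X X' Y Z : C} {s : Γ} (hZ : 𝒜.grading.comp s Z)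
    (D : Decomposition 𝒜.grading.comp Y) (p : X' ⟶ X) (q : Z ⟶ Y) :
    (𝒜.action.functor g).map (p ⊗ₘ q) ≫ 𝒜.action.incl (X ⊗ Y) g ≫
        𝒜.comulOf X D =
      (𝒜.γ g X' hZ).hom ≫ (((𝒜.action.functor (M.left s g)).map p ≫
        𝒜.action.incl X (M.left s g)) ⊗ₘ
          ((𝒜.action.functor g).map q ≫ 𝒜.action.incl Y g)) := by
  rw [comulOf, 𝒜.action.incl_desc, Preadditive.comp_sum, Finset.sum_eq_single s]
  · rw [← Functor.map_comp_assoc, ← id_tensorHom, tensorHom_comp_tensorHom, comp_id]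
    have n := 𝒜.γ_natural g hZ (D.mem s) p (q ≫ D.π s)
    rw [reassoc_of% n]
    have e : (𝒜.action.functor g).map (q ≫ D.π s) ≫ (𝒜.action.functor g).map (D.ι s) =
      (𝒜.action.functor g).map q := by rw [← Functor.map_comp, assoc, 𝒜.grading.comp_π_ι hZ]
    rw [tensorHom_comp_tensorHom, reassoc_of% e]
  · intro t _ ht
    rw [← Functor.map_comp_assoc, ← id_tensorHom, tensorHom_comp_tensorHom,
      𝒜.grading.hom_eq_zero hZ (D.mem t) ht.symm (q ≫ D.π t)]
    simp
  · simp

lemma map_tensor_comul (g : G) {X X' Y Z : C} {s : Γ} (hZ : 𝒜.grading.comp s Z)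
    (p : X' ⟶ X) (q : Z ⟶ Y) :
    (𝒜.action.functor g).map (p ⊗ₘ q) ≫ 𝒜.action.incl (X ⊗ Y) g ≫ 𝒜.comul X Y =
      (𝒜.γ g X' hZ).hom ≫ (((𝒜.action.functor (M.left s g)).map p ≫
        𝒜.action.incl X (M.left s g)) ⊗ₘ
          ((𝒜.action.functor g).map q ≫ 𝒜.action.incl Y g)) :=
  𝒜.map_tensor_comulOf g hZ _ p q

lemma map_tensor_comul_assoc (g : G) {X X' Y Z W : C} {s : Γ} (hZ : 𝒜.grading.comp s Z)
    (p : X' ⟶ X) (q : Z ⟶ Y)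
    (f : 𝒜.action.sumFunctor.obj X ⊗ 𝒜.action.sumFunctor.obj Y ⟶ W) :
    (𝒜.action.functor g).map (p ⊗ₘ q) ≫ 𝒜.action.incl (X ⊗ Y) g ≫ 𝒜.comul X Y ≫ f =
      (𝒜.γ g X' hZ).hom ≫ (((𝒜.action.functor (M.left s g)).map p ≫
        𝒜.action.incl X (M.left s g)) ⊗ₘ
          ((𝒜.action.functor g).map q ≫ 𝒜.action.incl Y g)) ≫ f :=
  (reassoc_of% (𝒜.map_tensor_comul g hZ p q)) f

lemma map_whiskerLeft_comul (g : G) {X Y Z : C} {s : Γ} (hZ : 𝒜.grading.comp s Z)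
    (q : Z ⟶ Y) :
    (𝒜.action.functor g).map (X ◁ q) ≫ 𝒜.action.incl (X ⊗ Y) g ≫ 𝒜.comul X Y =
      (𝒜.γ g X hZ).hom ≫ (𝒜.action.incl X (M.left s g) ⊗ₘ
          ((𝒜.action.functor g).map q ≫ 𝒜.action.incl Y g)) := by
  rw [← id_tensorHom, map_tensor_comul 𝒜 g hZ, CategoryTheory.Functor.map_id, id_comp]

lemma map_whiskerLeft_comul_assoc (g : G) {X Y Z W : C} {s : Γ} (hZ : 𝒜.grading.comp s Z)
    (q : Z ⟶ Y) (f : 𝒜.action.sumFunctor.obj X ⊗ 𝒜.action.sumFunctor.obj Y ⟶ W) :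
    (𝒜.action.functor g).map (X ◁ q) ≫ 𝒜.action.incl (X ⊗ Y) g ≫ 𝒜.comul X Y ≫ f =
      (𝒜.γ g X hZ).hom ≫ (𝒜.action.incl X (M.left s g) ⊗ₘ
          ((𝒜.action.functor g).map q ≫ 𝒜.action.incl Y g)) ≫ f :=
  (reassoc_of% (𝒜.map_whiskerLeft_comul g (X := X) hZ q)) f

lemma tensor_hom_ext {X Y W : C} {a b : 𝒜.action.sumFunctor.obj (X ⊗ Y) ⟶ W}
    (h : ∀ (g : G) (s : Γ) (Z : C) (_ : 𝒜.grading.comp s Z) (q : Z ⟶ Y),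
      (𝒜.action.functor g).map (X ◁ q) ≫ 𝒜.action.incl (X ⊗ Y) g ≫ a =
        (𝒜.action.functor g).map (X ◁ q) ≫ 𝒜.action.incl (X ⊗ Y) g ≫ b) : a = b :=
  𝒜.action.sum_hom_ext fun g =>
    𝒜.grading.map_hom_ext (tensorLeft X ⋙ 𝒜.action.functor g) fun s Z hZ q => h g s Z hZ q

/-- Both sides have the same values on homogeneous test objects, since the formula for them does not
mention `D`. -/
lemma comul_eq_comulOf (X : C) {Y : C} (D : Decomposition 𝒜.grading.comp Y) :
    𝒜.comul X Y = 𝒜.comulOf X D := by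
  refine 𝒜.tensor_hom_ext fun g s Z hZ q => ?_
  have := 𝒜.map_tensor_comulOf g hZ D (𝟙 X) q
  rw [id_tensorHom, CategoryTheory.Functor.map_id, id_comp] at this
  exact (𝒜.map_whiskerLeft_comul g hZ q).trans this.symm

lemma comul_naturality {X X' Y Y' : C} (p : X ⟶ X') (q : Y ⟶ Y') :
    𝒜.action.sumFunctor.map (p ⊗ₘ q) ≫ 𝒜.comul X' Y' =
      𝒜.comul X Y ≫ (𝒜.action.sumFunctor.map p ⊗ₘ 𝒜.action.sumFunctor.map q) := by
  refine 𝒜.tensor_hom_ext fun g s Z hZ f => ?_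
  rw [map_whiskerLeft_comul_assoc 𝒜 g hZ, ← assoc (𝒜.action.incl _ g), 𝒜.action.incl_map, assoc,
    ← Functor.map_comp_assoc, ← id_tensorHom, tensorHom_comp_tensorHom, id_comp,
    map_tensor_comul 𝒜 g hZ, tensorHom_comp_tensorHom, 𝒜.action.incl_map, assoc,
    𝒜.action.incl_map, Functor.map_comp, assoc]

lemma comul_assoc (X Y Z : C) :
    𝒜.comul (X ⊗ Y) Z ≫ 𝒜.comul X Y ▷ 𝒜.action.sumFunctor.obj Z ≫ (α_ _ _ _).hom =
      𝒜.action.sumFunctor.map (α_ X Y Z).hom ≫ 𝒜.comul X (Y ⊗ Z) ≫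
        𝒜.action.sumFunctor.obj X ◁ 𝒜.comul Y Z := by
  refine 𝒜.tensor_hom_ext fun g t Z' hZ q => ?_
  -- The last factor is now homogeneous; `γ_assoc` needs the middle factor to be homogeneous as
  -- well.
  refine 𝒜.grading.map_hom_ext (tensorLeft X ⋙ tensorRight Z' ⋙ 𝒜.action.functor g)
    fun s Y' hY p => ?_
  change (𝒜.action.functor g).map ((X ◁ p) ▷ Z') ≫ _ =
    (𝒜.action.functor g).map ((X ◁ p) ▷ Z') ≫ _
  rw [← Functor.map_comp_assoc, ← Functor.map_comp_assoc, ← MonoidalCategory.tensorHom_def,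
    map_tensor_comul_assoc 𝒜 g hZ, ← tensorHom_id, tensorHom_comp_tensorHom_assoc, assoc,
    map_whiskerLeft_comul 𝒜 _ hY, comp_id]
  rw [← assoc (𝒜.action.incl _ g), 𝒜.action.incl_map, assoc, ← Functor.map_comp_assoc,
    ← id_tensorHom, associator_naturality, Functor.map_comp_assoc,
    map_tensor_comul_assoc 𝒜 g (𝒜.grading.tensor_mem hY hZ), ← id_tensorHom,
    tensorHom_comp_tensorHom, assoc, assoc, map_tensor_comul 𝒜 g hZ, comp_id,
    CategoryTheory.Functor.map_id, id_comp]
  -- The two sides index the first factor by `s ▷ (t ▷ g)` and `(st) ▷ g`; the inclusions into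
  -- `T(X)` absorb the identification.
  have a := 𝒜.γ_assoc g X hY hZ
  rw [← 𝒜.action.cast_incl X (M.mul_left s t g),
    ← tensorHom_comp_tensorHom (𝒜.action.cast (M.mul_left s t g) X), ← reassoc_of% a,
    ← associator_naturality, ← tensorHom_id, tensorHom_comp_tensorHom_assoc, id_comp]

lemma comul_counit_left (X : C) :
    𝒜.comul (𝟙_ C) X ≫ 𝒜.counit ▷ 𝒜.action.sumFunctor.obj X ≫ (λ_ _).hom =
      𝒜.action.sumFunctor.map (λ_ X).hom := by
  refine 𝒜.tensor_hom_ext fun g s Z hZ q => ?_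
  rw [map_whiskerLeft_comul_assoc 𝒜 g hZ, ← tensorHom_id, tensorHom_comp_tensorHom_assoc,
    counit, 𝒜.action.incl_desc, comp_id, MonoidalCategory.tensorHom_def, assoc,
    leftUnitor_naturality, 𝒜.action.incl_map, ← Functor.map_comp_assoc, leftUnitor_naturality,
    Functor.map_comp, ← 𝒜.γ_unit_left g hZ]
  simp only [assoc]

lemma comul_counit_right [Simple (𝟙_ C)] (X : C) :
    𝒜.comul X (𝟙_ C) ≫ 𝒜.action.sumFunctor.obj X ◁ 𝒜.counit ≫ (ρ_ _).hom =
      𝒜.action.sumFunctor.map (ρ_ X).hom := by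
  refine 𝒜.action.sum_hom_ext fun g => ?_
  have h₁ := 𝒜.grading.comp_one_unit
  have e := 𝒜.map_whiskerLeft_comul_assoc g (X := X) h₁ (𝟙 _)
    (𝒜.action.sumFunctor.obj X ◁ 𝒜.counit ≫ (ρ_ _).hom)
  rw [whiskerLeft_id, CategoryTheory.Functor.map_id, id_comp] at e
  rw [e, CategoryTheory.Functor.map_id, id_comp, ← id_tensorHom, tensorHom_comp_tensorHom_assoc,
    counit, 𝒜.action.incl_desc, comp_id, 𝒜.action.incl_map, ← 𝒜.γ_unit_right g X h₁,
    ← 𝒜.action.cast_incl X (M.one_left g)]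
  simp only [assoc]
  rw [← rightUnitor_naturality, ← tensorHom_id, tensorHom_comp_tensorHom_assoc, comp_id]

/-- The comonoidal structure of `T = ⨁ g, ρ^g`. -/
@[reducible]
def oplaxMonoidal [Simple (𝟙_ C)] : 𝒜.action.sumFunctor.OplaxMonoidal where
  η := 𝒜.counit
  δ := 𝒜.comul
  δ_natural_left f X' := by
    have := 𝒜.comul_naturality f (𝟙 X')
    rw [CategoryTheory.Functor.map_id, tensorHom_id, tensorHom_id] at this
    exact this.symm
  δ_natural_right X' f := by
    have := 𝒜.comul_naturality (𝟙 X') f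
    rw [CategoryTheory.Functor.map_id, id_tensorHom, id_tensorHom] at this
    exact this.symm
  oplax_associativity := 𝒜.comul_assoc
  oplax_left_unitality X := by
    rw [← cancel_mono (λ_ (𝒜.action.sumFunctor.obj X)).hom, assoc, assoc, comul_counit_left,
      Iso.inv_hom_id, ← Functor.map_comp, Iso.inv_hom_id, CategoryTheory.Functor.map_id]
  oplax_right_unitality X := by
    rw [← cancel_mono (ρ_ (𝒜.action.sumFunctor.obj X)).hom, assoc, assoc, comul_counit_right,
      Iso.inv_hom_id, ← Functor.map_comp, Iso.inv_hom_id, CategoryTheory.Functor.map_id]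

lemma mulApp_comul (X Y : C) :
    𝒜.action.mulApp (X ⊗ Y) ≫ 𝒜.comul X Y =
      𝒜.action.sumFunctor.map (𝒜.comul X Y) ≫ 𝒜.comul _ _ ≫
        (𝒜.action.mulApp X ⊗ₘ 𝒜.action.mulApp Y) := by
  refine 𝒜.action.sum_hom_ext fun g => 𝒜.action.map_sum_hom_ext _ fun h => ?_
  refine 𝒜.grading.map_hom_ext
    (tensorLeft X ⋙ 𝒜.action.functor h ⋙ 𝒜.action.functor g) fun s Z hZ q => ?_
  change (𝒜.action.functor g).map ((𝒜.action.functor h).map (X ◁ q)) ≫ _ =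
    (𝒜.action.functor g).map ((𝒜.action.functor h).map (X ◁ q)) ≫ _
  have hm := 𝒜.action.incl_mulApp (X ⊗ Y) g h
  have hX := 𝒜.action.incl_mulApp X (M.left (M.right s h) g) (M.left s h)
  have hY := 𝒜.action.incl_mulApp Y g h
  have n := (𝒜.action.mul g h).hom.naturality (X ◁ q)
  have n' := (𝒜.action.mul g h).hom.naturality q
  rw [Functor.comp_map] at n n'
  -- The object `ρ^h(Z)` is homogeneous of degree `s ◁ h`, so the outer comultiplication is again
  -- given by `γ`.
  have hs := (𝒜.map_comp h s).le _ (ObjectProperty.prop_map_obj _ (𝒜.action.functor h) hZ)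
  rw [reassoc_of% hm, reassoc_of% n, map_whiskerLeft_comul 𝒜 _ hZ,
    ← assoc (𝒜.action.incl _ g), 𝒜.action.incl_map, assoc, ← Functor.map_comp_assoc,
    ← Functor.map_comp_assoc, assoc, map_whiskerLeft_comul 𝒜 _ hZ, Functor.map_comp_assoc,
    map_tensor_comul_assoc 𝒜 _ hs, tensorHom_comp_tensorHom, assoc, hX, assoc,
    Functor.map_comp, assoc, hY, reassoc_of% n']
  have c := 𝒜.γ_mul g h X hZ
  rw [reassoc_of% c, tensorHom_comp_tensorHom, assoc, 𝒜.action.cast_incl]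

lemma unitApp_comul (X Y : C) :
    𝒜.action.unitApp (X ⊗ Y) ≫ 𝒜.comul X Y = 𝒜.action.unitApp X ⊗ₘ 𝒜.action.unitApp Y := by
  refine 𝒜.grading.map_hom_ext (tensorLeft X) fun s Z hZ q => ?_
  change X ◁ q ≫ _ = X ◁ q ≫ _
  have n := 𝒜.action.one.hom.naturality (X ◁ q)
  have n' := 𝒜.action.one.hom.naturality q
  rw [Functor.id_map] at n n'
  have c := 𝒜.γ_one X hZ
  rw [RightAction.unitApp, assoc, reassoc_of% n, map_whiskerLeft_comul 𝒜 _ hZ, reassoc_of% c,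
    tensorHom_comp_tensorHom, assoc, 𝒜.action.cast_incl, ← reassoc_of% n', ← id_tensorHom,
    tensorHom_comp_tensorHom, id_comp]
  rfl

end CrossedAction

/-! ### Invertibility of the fusion operators -/

/-- By naturality and additivity `τ.app Y` is the direct sum of its values on the pieces of `Y`, so
it is inverted piece by piece. -/
lemma Grading.isIso_app {Γ : Type*} [Fintype Γ] [Group Γ] {C : Type u} [Category.{v} C]
    [Preadditive C] [HasFiniteBiproducts C] [MonoidalCategory C] (𝒢 : Grading Γ C)
    {F F' : C ⥤ C} [F.Additive] [F'.Additive] (τ : F ⟶ F')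
    (h : ∀ (s : Γ) (Z : C), 𝒢.comp s Z → IsIso (τ.app Z)) (Y : C) : IsIso (τ.app Y) := by
  obtain ⟨D⟩ := 𝒢.decomposition Y
  have := fun s => h s _ (D.mem s)
  refine ⟨∑ s, F'.map (D.π s) ≫ inv (τ.app (D.piece s)) ≫ F.map (D.ι s), ?_, ?_⟩
  · rw [Preadditive.comp_sum, ← F.map_id, ← D.sum_π_ι, F.map_sum]
    refine Finset.sum_congr rfl fun s _ => ?_
    rw [← NatTrans.naturality_assoc, IsIso.hom_inv_id_assoc, F.map_comp]
  · rw [Preadditive.sum_comp, ← F'.map_id, ← D.sum_π_ι, F'.map_sum]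
    refine Finset.sum_congr rfl fun s _ => ?_
    rw [assoc, assoc, NatTrans.naturality, IsIso.inv_hom_id_assoc, F'.map_comp]

section

variable {k : Type w} [Field k] {G : Type*} [Group G] [Fintype G]
  {C : Type u} [Category.{v} C] [Preadditive C] [HasFiniteBiproducts C] [Linear k C]
  (ρ : RightAction k G C)

instance RightAction.sumFunctor_additive : ρ.sumFunctor.Additive where
  map_add {X Y f g} := by
    refine ρ.sum_hom_ext fun a => ?_
    rw [Preadditive.comp_add, ρ.incl_map, ρ.incl_map, ρ.incl_map, Functor.map_add,
      Preadditive.add_comp]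

/-- With respect to the summands, `f` is a permutation matrix with invertible entries. Orthogonality
is used only in the target; in the source it suffices that the `π i ≫ ι i` add up to the identity.
-/
lemma isIso_to_sum_tensor_sum [MonoidalCategory C] [MonoidalPreadditive C] {A X Y : C}
    (f : A ⟶ ρ.sumFunctor.obj X ⊗ ρ.sumFunctor.obj Y) {P : G × G → C}
    (ι : ∀ i, P i ⟶ A) (π : ∀ i, A ⟶ P i) (total : ∑ i, π i ≫ ι i = 𝟙 A)
    (σ : G × G → G × G) (hσ : Function.Bijective σ)
    (e : ∀ i, P i ⟶ (ρ.functor (σ i).1).obj X ⊗ (ρ.functor (σ i).2).obj Y) [∀ i, IsIso (e i)]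
    (h : ∀ i, ι i ≫ f = e i ≫ (ρ.incl X (σ i).1 ⊗ₘ ρ.incl Y (σ i).2)) : IsIso f := by
  have orth : ∀ i j, i ≠ j → (ρ.incl X (σ i).1 ⊗ₘ ρ.incl Y (σ i).2) ≫
      (ρ.proj X (σ j).1 ⊗ₘ ρ.proj Y (σ j).2) = 0 := by
    intro i j hij
    rw [tensorHom_comp_tensorHom]
    by_cases h₁ : (σ i).1 = (σ j).1
    · have h₂ : (σ i).2 ≠ (σ j).2 := fun h₂ => hij (hσ.1 (Prod.ext h₁ h₂))
      rw [ρ.incl_proj_ne Y h₂, MonoidalPreadditive.tensor_zero]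
    · rw [ρ.incl_proj_ne X h₁, MonoidalPreadditive.zero_tensor]
  have self : ∀ i, (ρ.incl X (σ i).1 ⊗ₘ ρ.incl Y (σ i).2) ≫
      (ρ.proj X (σ i).1 ⊗ₘ ρ.proj Y (σ i).2) = 𝟙 _ := by
    intro i
    rw [tensorHom_comp_tensorHom, ρ.incl_proj_self, ρ.incl_proj_self, id_tensorHom_id]
  have total' : ∑ i, (ρ.proj X (σ i).1 ⊗ₘ ρ.proj Y (σ i).2) ≫
      (ρ.incl X (σ i).1 ⊗ₘ ρ.incl Y (σ i).2) = 𝟙 _ := by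
    have := (Equiv.ofBijective σ hσ).sum_comp
      (fun j => (ρ.proj X j.1 ⊗ₘ ρ.proj Y j.2) ≫ (ρ.incl X j.1 ⊗ₘ ρ.incl Y j.2))
    refine this.trans ?_
    rw [Fintype.sum_prod_type, ← id_tensorHom_id, ← ρ.sum_total X, ← ρ.sum_total Y, sum_tensor]
    simp only [tensorHom_comp_tensorHom, tensor_sum]
  have hf : ∑ i, π i ≫ e i ≫ (ρ.incl X (σ i).1 ⊗ₘ ρ.incl Y (σ i).2) = f := by
    rw [← id_comp f, ← total, Preadditive.sum_comp]
    exact Finset.sum_congr rfl fun i _ => by rw [assoc, h]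
  refine ⟨∑ i, (ρ.proj X (σ i).1 ⊗ₘ ρ.proj Y (σ i).2) ≫ inv (e i) ≫ ι i, ?_, ?_⟩
  · rw [← total, ← hf, Preadditive.sum_comp]
    refine Finset.sum_congr rfl fun i _ => ?_
    rw [Preadditive.comp_sum, Finset.sum_eq_single i]
    · rw [assoc, assoc, reassoc_of% (self i), IsIso.hom_inv_id_assoc]
    · intro j _ hj
      rw [assoc, assoc, reassoc_of% (orth i j hj.symm), zero_comp, comp_zero, comp_zero]
    · simp
  · rw [← total', Preadditive.sum_comp]
    refine Finset.sum_congr rfl fun i _ => ?_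
    rw [assoc, assoc, h, IsIso.inv_hom_id_assoc]

end

/-! ### The permutations of `G × G` behind the fusion operators. -/

namespace MatchedPair

variable {G Γ : Type*} [Group G] [Group Γ] (M : MatchedPair G Γ)

lemma left_injective (s : Γ) : Function.Injective (M.left s) := fun g h e => by
  have := congrArg (M.left s⁻¹) e
  rwa [← M.mul_left, ← M.mul_left, inv_mul_cancel, M.one_left, M.one_left] at this

/-- Since `s ▷ (hg) = (s ▷ h)((s ◁ h) ▷ g)`, the two coordinates determine `s ▷ h`, hence `h`, hence
`g`; finiteness of `G` does the rest. -/
lemma bijective_left_fusion [Finite G] (s : Γ) : Function.Bijective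
    fun i : G × G => (M.left (M.right s i.2) i.1, i.2 * i.1) := by
  refine Finite.injective_iff_bijective.mp ?_
  rintro ⟨g, h⟩ ⟨g', h'⟩ e
  obtain ⟨e₁, e₂⟩ := Prod.mk.inj e
  have e₃ : M.left s (h * g) = M.left s (h' * g') := congrArg _ e₂
  dsimp only at e₁ e₂
  rw [M.left_mul, M.left_mul, e₁, mul_left_inj] at e₃
  obtain rfl := M.left_injective s e₃
  rw [mul_left_cancel e₂]

lemma bijective_right_fusion [Finite G] (s : Γ) : Function.Bijective
    fun i : G × G => (i.2 * M.left s i.1, i.1) := by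
  refine Finite.injective_iff_bijective.mp ?_
  rintro ⟨g, h⟩ ⟨g', h'⟩ e
  obtain ⟨e₁, rfl⟩ := Prod.mk.inj e
  dsimp only at e₁
  rw [mul_right_cancel e₁]

end MatchedPair

namespace CrossedAction

variable {k : Type w} [Field k] {G Γ : Type*} [Group G] [Group Γ] [Fintype G] [Fintype Γ]
  {M : MatchedPair G Γ} {C : Type u} [Category.{v} C] [Preadditive C]
  [HasFiniteBiproducts C] [Linear k C] [MonoidalCategory C] [MonoidalPreadditive C]
  (𝒜 : CrossedAction k M C)

lemma comul_naturality_right (X : C) {Y Y' : C} (q : Y ⟶ Y') :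
    𝒜.action.sumFunctor.map (X ◁ q) ≫ 𝒜.comul X Y' =
      𝒜.comul X Y ≫ 𝒜.action.sumFunctor.obj X ◁ 𝒜.action.sumFunctor.map q := by
  have := 𝒜.comul_naturality (𝟙 X) q
  rwa [CategoryTheory.Functor.map_id, id_tensorHom, id_tensorHom] at this

lemma isIso_comul_mulApp_left (X Y : C) :
    IsIso (𝒜.comul X (𝒜.action.sumFunctor.obj Y) ≫
      𝒜.action.sumFunctor.obj X ◁ 𝒜.action.mulApp Y) := by
  -- The fusion operator is viewed as a transformation natural in `Y` between additive functors, so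
  -- that `Y` may be taken homogeneous.
  let τ : 𝒜.action.sumFunctor ⋙ tensorLeft X ⋙ 𝒜.action.sumFunctor ⟶
      𝒜.action.sumFunctor ⋙ tensorLeft (𝒜.action.sumFunctor.obj X) :=
    { app := fun Y => 𝒜.comul X (𝒜.action.sumFunctor.obj Y) ≫
        𝒜.action.sumFunctor.obj X ◁ 𝒜.action.mulApp Y
      naturality := fun Y Y' f => by
        change 𝒜.action.sumFunctor.map (X ◁ 𝒜.action.sumFunctor.map f) ≫ _ ≫ _ =
          _ ≫ 𝒜.action.sumFunctor.obj X ◁ 𝒜.action.sumFunctor.map f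
        have n := 𝒜.comul_naturality_right X (𝒜.action.sumFunctor.map f)
        rw [reassoc_of% n, assoc, ← whiskerLeft_comp, ← whiskerLeft_comp, mulApp_naturality] }
  refine 𝒜.grading.isIso_app τ (fun s Z hZ => ?_) Y
  refine isIso_to_sum_tensor_sum 𝒜.action _
    (P := fun i => (𝒜.action.functor i.1).obj (X ⊗ (𝒜.action.functor i.2).obj Z))
    (fun i => (𝒜.action.functor i.1).map (X ◁ 𝒜.action.incl Z i.2) ≫ 𝒜.action.incl _ i.1)
    (fun i => 𝒜.action.proj _ i.1 ≫ (𝒜.action.functor i.1).map (X ◁ 𝒜.action.proj Z i.2))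
    ?_ _ (M.bijective_left_fusion s)
    (fun i => (𝒜.γ i.1 X ((𝒜.map_comp i.2 s).le _ (ObjectProperty.prop_map_obj _ _ hZ))).hom ≫
      _ ◁ (𝒜.action.mul i.1 i.2).hom.app Z) ?_
  -- The summands `ρ^g(X ⊗ ρ^h Z)` exhaust `T(X ⊗ T(Z))`: decompose the outer `T`, then the inner
  -- one inside each `ρ^g`.
  · rw [Fintype.sum_prod_type]
    change _ = 𝟙 (𝒜.action.sumFunctor.obj (X ⊗ 𝒜.action.sumFunctor.obj Z))
    rw [← 𝒜.action.sum_total]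
    refine Finset.sum_congr rfl fun g _ => ?_
    have e : ∑ h, (𝒜.action.functor g).map (X ◁ 𝒜.action.proj Z h) ≫
        (𝒜.action.functor g).map (X ◁ 𝒜.action.incl Z h) = 𝟙 _ := by
      simp only [← Functor.map_comp, ← whiskerLeft_comp]
      rw [← Functor.map_sum, ← whiskerLeft_sum, 𝒜.action.sum_total, whiskerLeft_id,
        CategoryTheory.Functor.map_id]
    have e' := congrArg (fun z => 𝒜.action.proj (X ⊗ 𝒜.action.sumFunctor.obj Z) g ≫ z ≫
      𝒜.action.incl (X ⊗ 𝒜.action.sumFunctor.obj Z) g) e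
    rw [Preadditive.sum_comp, Preadditive.comp_sum, id_comp] at e'
    rw [← e']
    exact Finset.sum_congr rfl fun h _ => by simp only [assoc]; rfl
  · rintro ⟨g, h⟩
    have hm := 𝒜.action.incl_mulApp Z g h
    have hs := (𝒜.map_comp h s).le _ (ObjectProperty.prop_map_obj _ (𝒜.action.functor h) hZ)
    change ((𝒜.action.functor g).map (X ◁ 𝒜.action.incl Z h) ≫ 𝒜.action.incl _ g) ≫
      𝒜.comul X (𝒜.action.sumFunctor.obj Z) ≫
        𝒜.action.sumFunctor.obj X ◁ 𝒜.action.mulApp Z = _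
    rw [assoc, map_whiskerLeft_comul_assoc 𝒜 g hs, ← id_tensorHom, tensorHom_comp_tensorHom,
      assoc, hm, comp_id, ← id_tensorHom, assoc, tensorHom_comp_tensorHom, id_comp]

lemma isIso_comul_mulApp_right (X Y : C) :
    IsIso (𝒜.comul (𝒜.action.sumFunctor.obj X) Y ≫
      𝒜.action.mulApp X ▷ 𝒜.action.sumFunctor.obj Y) := by
  let τ : tensorLeft (𝒜.action.sumFunctor.obj X) ⋙ 𝒜.action.sumFunctor ⟶
      𝒜.action.sumFunctor ⋙ tensorLeft (𝒜.action.sumFunctor.obj X) :=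
    { app := fun Y => 𝒜.comul (𝒜.action.sumFunctor.obj X) Y ≫
        𝒜.action.mulApp X ▷ 𝒜.action.sumFunctor.obj Y
      naturality := fun Y Y' f => by
        change 𝒜.action.sumFunctor.map (𝒜.action.sumFunctor.obj X ◁ f) ≫ _ ≫ _ =
          _ ≫ 𝒜.action.sumFunctor.obj X ◁ 𝒜.action.sumFunctor.map f
        have n := 𝒜.comul_naturality_right (𝒜.action.sumFunctor.obj X) f
        rw [reassoc_of% n, assoc, whisker_exchange] }
  -- Here too the grading is used in the second variable, the one on which `γ` depends through its
  -- degree; `X` stays arbitrary.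
  refine 𝒜.grading.isIso_app τ (fun s Z hZ => ?_) Y
  refine isIso_to_sum_tensor_sum 𝒜.action _
    (P := fun i => (𝒜.action.functor i.1).obj ((𝒜.action.functor i.2).obj X ⊗ Z))
    (fun i => (𝒜.action.functor i.1).map (𝒜.action.incl X i.2 ▷ Z) ≫ 𝒜.action.incl _ i.1)
    (fun i => 𝒜.action.proj _ i.1 ≫ (𝒜.action.functor i.1).map (𝒜.action.proj X i.2 ▷ Z))
    ?_ _ (M.bijective_right_fusion s)
    (fun i => (𝒜.γ i.1 ((𝒜.action.functor i.2).obj X) hZ).hom ≫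
      (𝒜.action.mul (M.left s i.1) i.2).hom.app X ▷ _) ?_
  · rw [Fintype.sum_prod_type]
    change _ = 𝟙 (𝒜.action.sumFunctor.obj (𝒜.action.sumFunctor.obj X ⊗ Z))
    rw [← 𝒜.action.sum_total]
    refine Finset.sum_congr rfl fun g _ => ?_
    have e : ∑ h, (𝒜.action.functor g).map (𝒜.action.proj X h ▷ Z) ≫
        (𝒜.action.functor g).map (𝒜.action.incl X h ▷ Z) = 𝟙 _ := by
      simp only [← Functor.map_comp, ← comp_whiskerRight]
      rw [← Functor.map_sum, ← sum_whiskerRight, 𝒜.action.sum_total, id_whiskerRight,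
        CategoryTheory.Functor.map_id]
    have e' := congrArg (fun z => 𝒜.action.proj (𝒜.action.sumFunctor.obj X ⊗ Z) g ≫ z ≫
      𝒜.action.incl (𝒜.action.sumFunctor.obj X ⊗ Z) g) e
    rw [Preadditive.sum_comp, Preadditive.comp_sum, id_comp] at e'
    rw [← e']
    exact Finset.sum_congr rfl fun h _ => by simp only [assoc]; rfl
  · rintro ⟨g, h⟩
    have hm := 𝒜.action.incl_mulApp X (M.left s g) h
    change ((𝒜.action.functor g).map (𝒜.action.incl X h ▷ Z) ≫ 𝒜.action.incl _ g) ≫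
      𝒜.comul (𝒜.action.sumFunctor.obj X) Z ≫
        𝒜.action.mulApp X ▷ 𝒜.action.sumFunctor.obj Z = _
    rw [assoc, ← tensorHom_id, map_tensor_comul_assoc 𝒜 g hZ, ← tensorHom_id,
      tensorHom_comp_tensorHom, assoc, hm, comp_id, CategoryTheory.Functor.map_id, id_comp,
      ← tensorHom_id, assoc, tensorHom_comp_tensorHom, id_comp]

/-- The comonoidal structure of the monad of a crossed action. -/
@[reducible]
def monadOplaxMonoidal [Simple (𝟙_ C)] : 𝒜.action.monad.toFunctor.OplaxMonoidal :=
  𝒜.oplaxMonoidal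

/-- The monad of a crossed action on a category with simple unit object is a Hopf monad. -/
lemma isHopfMonad [Simple (𝟙_ C)] : IsHopfMonad 𝒜.action.monad 𝒜.monadOplaxMonoidal where
  mul_tensor := 𝒜.mulApp_comul
  mul_unit := 𝒜.mulApp_counit
  unit_tensor := 𝒜.unitApp_comul
  unit_unit := 𝒜.unitApp_counit
  left_fusion := 𝒜.isIso_comul_mulApp_left
  right_fusion := 𝒜.isIso_comul_mulApp_right

end CrossedAction

/-! ### Equivariant objects as modules -/

section Modules

variable {k : Type w} [Field k] {G : Type*} [Group G]
  {C : Type u} [Category.{v} C] [Preadditive C] [Linear k C]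
  (ρ : RightAction k G C)

/-- Modules over `T` do not presuppose invertible components. Modulo `ρ_2`, the composite of
`ρ^a(act a⁻¹)` and `act a` is `act 1`, which inverts `ρ_0`. With `a = g` this makes `act g` split
epi; with `a = g⁻¹` it makes `ρ^{g⁻¹}(act g)` mono, and the equivalence `ρ^{g⁻¹}` reflects that. -/
lemma RightAction.isIso_of_act {X : C} (act : ∀ g : G, (ρ.functor g).obj X ⟶ X)
    (act_mul : ∀ g h, (ρ.functor g).map (act h) ≫ act g = (ρ.mul g h).hom.app X ≫ act (h * g))
    (act_one : ρ.one.hom.app X ≫ act 1 = 𝟙 X) (g : G) : IsIso (act g) := by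
  -- Stated for `a = 1` as a hypothesis because it is applied to the product `a⁻¹ * a`.
  have h₁ : ∀ a : G, a = 1 → IsIso (act a) := by
    rintro _ rfl
    have : IsIso (ρ.one.hom.app X ≫ act 1) := by rw [act_one]; exact inferInstanceAs (IsIso (𝟙 X))
    exact IsIso.of_isIso_comp_left (ρ.one.hom.app X) (act 1)
  have h₂ : ∀ a : G, IsIso ((ρ.functor a).map (act a⁻¹) ≫ act a) := fun a => by
    have := h₁ (a⁻¹ * a) (inv_mul_cancel a)
    rw [act_mul]
    infer_instance
  have : IsSplitEpi (act g) := by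
    have := h₂ g
    exact ⟨⟨⟨inv ((ρ.functor g).map (act g⁻¹) ≫ act g) ≫ (ρ.functor g).map (act g⁻¹), by
      rw [assoc, IsIso.inv_hom_id]⟩⟩⟩
  have : Mono (act g) := by
    have h₃ := h₂ g⁻¹
    rw [inv_inv] at h₃
    have := mono_of_mono ((ρ.functor g⁻¹).map (act g)) (act g⁻¹)
    exact (ρ.functor g⁻¹).mono_of_mono_map this
  exact isIso_of_mono_of_isSplitEpi (act g)

variable [HasFiniteBiproducts C] [Fintype G]

lemma RightAction.map_incl_comp {X : C} {a : ρ.sumFunctor.obj X ⟶ X}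
    (h : ρ.mulApp X ≫ a = ρ.sumFunctor.map a ≫ a) (g g' : G) :
    (ρ.functor g).map (ρ.incl X g' ≫ a) ≫ ρ.incl X g ≫ a =
      (ρ.mul g g').hom.app X ≫ ρ.incl X (g' * g) ≫ a := by
  have e₁ := ρ.incl_map a g
  have e₂ := ρ.incl_mulApp X g g'
  rw [← reassoc_of% e₂, h, reassoc_of% e₁, Functor.map_comp, assoc]

lemma RightAction.one_incl_comp {X : C} {a : ρ.sumFunctor.obj X ⟶ X}
    (h : ρ.unitApp X ≫ a = 𝟙 X) : ρ.one.hom.app X ≫ ρ.incl X 1 ≫ a = 𝟙 X := by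
  rw [← h, RightAction.unitApp, assoc]

lemma RightAction.incl_comp_comm {X Y : C} {a : ρ.sumFunctor.obj X ⟶ X}
    {b : ρ.sumFunctor.obj Y ⟶ Y} {f : X ⟶ Y} (h : ρ.sumFunctor.map f ≫ b = a ≫ f) (g : G) :
    (ρ.incl X g ≫ a) ≫ f = (ρ.functor g).map f ≫ ρ.incl Y g ≫ b := by
  have e := ρ.incl_map f g
  rw [assoc, ← h, reassoc_of% e]

/-- A `T`-module as an equivariant object. -/
def RightAction.ofModules : ρ.monad.Algebra ⥤ EquivariantObject ρ where
  obj B :=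
    { obj := B.A
      act := fun g => ρ.incl B.A g ≫ B.a
      isIso_act := ρ.isIso_of_act _ (ρ.map_incl_comp B.assoc) (ρ.one_incl_comp B.unit)
      act_mul := ρ.map_incl_comp B.assoc
      act_one := ρ.one_incl_comp B.unit }
  map f :=
    { hom := f.f
      comm := ρ.incl_comp_comm f.h }

lemma RightAction.desc_incl {X Z : C} (f : ρ.sumFunctor.obj X ⟶ Z) :
    ρ.desc (fun g => ρ.incl X g ≫ f) = f :=
  ρ.sum_hom_ext fun g => ρ.incl_desc _ g

/-- Modules over `T` are the same as equivariant objects. -/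
def RightAction.modulesEquivalence : ρ.monad.Algebra ≌ EquivariantObject ρ where
  functor := ρ.ofModules
  inverse := ρ.toModules
  unitIso := NatIso.ofComponents
    (fun B => Monad.Algebra.isoMk (Iso.refl B.A) (by
      change ρ.sumFunctor.map (𝟙 B.A) ≫ ρ.desc (fun g => ρ.incl B.A g ≫ B.a) = B.a ≫ 𝟙 B.A
      rw [CategoryTheory.Functor.map_id, id_comp, comp_id]
      exact ρ.desc_incl B.a))
    (fun {B B'} f => Monad.Algebra.Hom.ext' _ _ _ _
      (show f.f ≫ 𝟙 B'.A = 𝟙 B.A ≫ f.f by rw [id_comp, comp_id]))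
  counitIso := NatIso.ofComponents
    (fun A =>
      { hom := ⟨𝟙 A.obj, fun g => by
          change (ρ.incl A.obj g ≫ ρ.desc A.act) ≫ 𝟙 A.obj =
            (ρ.functor g).map (𝟙 A.obj) ≫ A.act g
          rw [ρ.incl_desc, CategoryTheory.Functor.map_id, id_comp, comp_id]⟩
        inv := ⟨𝟙 A.obj, fun g => by
          change A.act g ≫ 𝟙 A.obj =
            (ρ.functor g).map (𝟙 A.obj) ≫ ρ.incl A.obj g ≫ ρ.desc A.act
          rw [ρ.incl_desc, CategoryTheory.Functor.map_id, id_comp, comp_id]⟩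
        hom_inv_id := EquivariantObject.hom_ext (id_comp (𝟙 A.obj))
        inv_hom_id := EquivariantObject.hom_ext (id_comp (𝟙 A.obj)) })
    (fun {A A'} f => EquivariantObject.hom_ext
      (show f.hom ≫ 𝟙 A'.obj = 𝟙 A.obj ≫ f.hom by rw [id_comp, comp_id]))
  functor_unitIso_comp B := EquivariantObject.hom_ext (id_comp (𝟙 B.A))

lemma RightAction.isEquivalence_toModules : ρ.toModules.IsEquivalence :=
  inferInstanceAs ρ.modulesEquivalence.inverse.IsEquivalence

end Modules

/-- The data that induce a monoidal structure along an equivalence. -/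
def transportInducing {C D : Type*} [Category C] [MonoidalCategory C] [Category D] (e : C ≌ D) :
    letI := Monoidal.transportStruct e
    Monoidal.InducingFunctorData e.inverse :=
  letI := Monoidal.transportStruct e
  -- For `modulesEquivalence` the unit has identity components, so the transported structure keeps
  -- the underlying objects and the forgetful functor stays strict.
  { μIso := fun _ _ => e.unitIso.app _
    εIso := e.unitIso.app _
    whiskerLeft_eq := by simp +zetaDelta +instances [Monoidal.transportStruct]
    whiskerRight_eq := by simp +zetaDelta +instances [Monoidal.transportStruct]
    tensorHom_eq := by simp +zetaDelta +instances [Monoidal.transportStruct]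
    associator_eq := by simp +zetaDelta +instances [Monoidal.transportStruct]
    leftUnitor_eq := by simp +zetaDelta +instances [Monoidal.transportStruct]
    rightUnitor_eq := by simp +zetaDelta +instances [Monoidal.transportStruct] }

/-! ### The twisted tensor product of equivariant objects. -/

namespace CrossedAction

variable {k : Type w} [Field k] {G Γ : Type*} [Group G] [Group Γ] [Fintype G] [Fintype Γ]
  {M : MatchedPair G Γ} {C : Type u} [Category.{v} C] [Preadditive C]
  [HasFiniteBiproducts C] [Linear k C] [MonoidalCategory C] [MonoidalPreadditive C]
  (𝒜 : CrossedAction k M C)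

/-- The twisted action is the component at `g` of the tensor product of `T`-modules. Cutting `r'^g`
down to degree `s ◁ g` loses nothing, because `ρ^g(Y_s)` is homogeneous of that degree. -/
lemma tensorAct_eq (A B : 𝒜.Equivariantization) (D : Decomposition 𝒜.grading.comp B.obj) (g : G) :
    𝒜.tensorAct A B D g = 𝒜.action.incl (A.obj ⊗ B.obj) g ≫ 𝒜.comul A.obj B.obj ≫
      (𝒜.action.desc A.act ⊗ₘ 𝒜.action.desc B.act) := by
  rw [𝒜.comul_eq_comulOf A.obj D, comulOf, ← assoc, 𝒜.action.incl_desc, Preadditive.sum_comp,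
    tensorAct]
  refine Finset.sum_congr rfl fun s _ => ?_
  have hs := (𝒜.map_comp g s).le _
    (ObjectProperty.prop_map_obj _ (𝒜.action.functor g) (D.mem s))
  have e := 𝒜.grading.comp_π_ι hs D ((𝒜.action.functor g).map (D.ι s) ≫ B.act g)
  rw [assoc] at e
  rw [assoc, assoc, tensorHom_comp_tensorHom, assoc, 𝒜.action.incl_desc, 𝒜.action.incl_desc,
    ← id_tensorHom A.obj (D.ι _), tensorHom_comp_tensorHom, comp_id, actPiece, assoc, assoc, e]

variable [Simple (𝟙_ C)]

/-- The monoidal category of modules over the Hopf monad of a crossed action. -/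
@[reducible]
def modulesMonoidal : MonoidalCategory 𝒜.action.monad.Algebra :=
  IsHopfMonad.algebraMonoidal (O := 𝒜.monadOplaxMonoidal) 𝒜.isHopfMonad

/-- The monoidal structure of the equivariantization. -/
@[reducible]
def equivariantMonoidal : MonoidalCategory 𝒜.Equivariantization :=
  letI := 𝒜.modulesMonoidal
  letI := Monoidal.transportStruct 𝒜.action.modulesEquivalence
  Monoidal.induced _ (transportInducing 𝒜.action.modulesEquivalence)

/-- The functor from the equivariantization to modules is monoidal. -/
@[reducible]
def toModulesMonoidal :
    letI := 𝒜.modulesMonoidal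
    letI := 𝒜.equivariantMonoidal
    𝒜.action.toModules.Monoidal :=
  letI := 𝒜.modulesMonoidal
  letI := Monoidal.transportStruct 𝒜.action.modulesEquivalence
  Monoidal.fromInducedMonoidal 𝒜.action.modulesEquivalence.inverse
    (transportInducing 𝒜.action.modulesEquivalence)

/-- The equivariantization of a rigid category under a crossed action is rigid. -/
@[reducible]
def equivariantRigid [RigidCategory C] :
    letI := 𝒜.equivariantMonoidal
    RigidCategory 𝒜.Equivariantization :=
  letI := 𝒜.modulesMonoidal
  letI := 𝒜.equivariantMonoidal
  letI := 𝒜.toModulesMonoidal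
  letI : RigidCategory 𝒜.action.monad.Algebra :=
    IsHopfMonad.algebraRigid (O := 𝒜.monadOplaxMonoidal) 𝒜.isHopfMonad
  haveI := 𝒜.action.isEquivalence_toModules
  rigidCategoryOfEquivalence 𝒜.action.modulesEquivalence.symm.toAdjunction

/-- The forgetful functor from the equivariantization is strict monoidal. -/
@[reducible]
def forgetMonoidal :
    letI := 𝒜.equivariantMonoidal
    (EquivariantObject.forget 𝒜.action).Monoidal :=
  letI := 𝒜.modulesMonoidal
  letI := 𝒜.equivariantMonoidal
  letI := 𝒜.toModulesMonoidal
  letI : 𝒜.action.monad.forget.Monoidal :=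
    IsHopfMonad.forgetMonoidal (O := 𝒜.monadOplaxMonoidal) 𝒜.isHopfMonad
  inferInstanceAs (𝒜.action.toModules ⋙ 𝒜.action.monad.forget).Monoidal

lemma isTwistedMonoidal :
    letI := 𝒜.equivariantMonoidal
    𝒜.IsTwistedMonoidal :=
  letI := 𝒜.equivariantMonoidal
  { tensor_obj := fun _ _ => rfl
    tensor_act := fun A B D g => by
      change 𝒜.action.incl (A.obj ⊗ B.obj) g ≫ 𝒜.comul A.obj B.obj ≫
          (𝒜.action.desc A.act ⊗ₘ 𝒜.action.desc B.act) =
        (𝒜.action.functor g).map (𝟙 (A.obj ⊗ B.obj)) ≫ 𝒜.tensorAct A B D g ≫ 𝟙 (A.obj ⊗ B.obj)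
      rw [CategoryTheory.Functor.map_id, id_comp, comp_id, 𝒜.tensorAct_eq]
    unit_obj := rfl
    unit_act := fun g => by
      change 𝒜.action.incl (𝟙_ C) g ≫ 𝒜.counit =
        (𝒜.action.functor g).map (𝟙 (𝟙_ C)) ≫ (𝒜.γ₀ g).hom ≫ 𝟙 (𝟙_ C)
      rw [CategoryTheory.Functor.map_id, id_comp, comp_id]
      exact 𝒜.action.incl_desc _ g
    forget_strict := ⟨𝒜.forgetMonoidal, fun A B => id_comp _, id_comp _⟩ }

end CrossedAction

/-! ### The equivariantization is a tensor category -/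

/-- A preadditive category with kernels, cokernels and finite products is abelian if it has a
conservative functor to an abelian category that preserves kernels and cokernels. -/
lemma exists_abelian_of_conservative {D C : Type*} [Category D] [P : Preadditive D] [Category C]
    [Abelian C] (U : D ⥤ C) [U.PreservesZeroMorphisms] [U.ReflectsIsomorphisms]
    [HasFiniteProducts D] [HasKernels D] [HasCokernels D]
    [PreservesLimitsOfShape WalkingParallelPair U]
    [PreservesColimitsOfShape WalkingParallelPair U] : ∃ A : Abelian D, A.toPreadditive = P := by
  -- Preserving kernels and cokernels, `U` carries the comparison from coimage to image to the one
  -- in `C`, which is invertible; conservativity lifts this.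
  have : ∀ {X Y : D} (f : X ⟶ Y), IsIso (Abelian.coimageImageComparison f) := by
    intro X Y f
    have : IsIso (U.map (Abelian.coimageImageComparison f)) := by
      rw [Arrow.isIso_iff_isIso_of_isIso (Abelian.PreservesCoimageImageComparison.iso U f).hom]
      infer_instance
    exact isIso_of_reflects_iso _ U
  exact ⟨Abelian.ofCoimageImageComparisonIsIso, rfl⟩

/-! ### Chain conditions along a functor that lifts factorizations. -/

section Subobjects

variable {D C : Type*} [Category D] [Category C] (U : D ⥤ C) [U.PreservesMonomorphisms]

/-- The lifting hypothesis makes the map on subobjects reflect the order, so strict chains stay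
strict and both chain conditions descend from `C`. -/
lemma strictMono_subobject_map
    (lift : ∀ {X Y Z : D} (m : Y ⟶ Z) [Mono m] (n : X ⟶ Z) (f : U.obj X ⟶ U.obj Y),
      f ≫ U.map m = U.map n → ∃ f' : X ⟶ Y, f' ≫ m = n) (X : D) :
    StrictMono fun S : Subobject X => Subobject.mk (U.map S.arrow) := by
  intro S S' h
  refine lt_of_le_not_ge ?_ fun h' => ?_
  · exact Subobject.mk_le_mk_of_comm (U.map (Subobject.ofLE _ _ h.le))
      (by rw [← U.map_comp, Subobject.ofLE_arrow])
  · obtain ⟨f', hf'⟩ := lift S.arrow S'.arrow (Subobject.ofMkLEMk _ _ h')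
      (Subobject.ofMkLEMk_comp h')
    exact absurd (Subobject.le_of_comm f' hf') (not_le_of_gt h)

lemma isNoetherianObject_of_map
    (lift : ∀ {X Y Z : D} (m : Y ⟶ Z) [Mono m] (n : X ⟶ Z) (f : U.obj X ⟶ U.obj Y),
      f ≫ U.map m = U.map n → ∃ f' : X ⟶ Y, f' ≫ m = n)
    {X : D} (h : IsNoetherianObject (U.obj X)) :
    IsNoetherianObject X :=
  ⟨(strictMono_subobject_map U lift X).wellFoundedGT⟩

lemma isArtinianObject_of_map
    (lift : ∀ {X Y Z : D} (m : Y ⟶ Z) [Mono m] (n : X ⟶ Z) (f : U.obj X ⟶ U.obj Y),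
      f ≫ U.map m = U.map n → ∃ f' : X ⟶ Y, f' ≫ m = n)
    {X : D} (h : IsArtinianObject (U.obj X)) :
    IsArtinianObject X :=
  ⟨(strictMono_subobject_map U lift X).wellFoundedLT⟩

end Subobjects

section Equivariant

variable {k : Type w} [Field k] {G : Type*} [Group G]
  {C : Type u} [Category.{v} C] [Preadditive C] [Linear k C] (ρ : RightAction k G C)

/-- The factorization `f` is automatically equivariant, as is seen after composing with the
monomorphism `m.hom`. -/
lemma EquivariantObject.exists_lift {X Y Z : EquivariantObject ρ} (m : Y ⟶ Z)
    [Mono m.hom] (n : X ⟶ Z) (f : X.obj ⟶ Y.obj) (h : f ≫ m.hom = n.hom) :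
    ∃ f' : X ⟶ Y, f' ≫ m = n := by
  refine ⟨⟨f, fun g => ?_⟩, EquivariantObject.hom_ext h⟩
  rw [← cancel_mono m.hom, assoc, h, n.comm, assoc, m.comm, ← Functor.map_comp_assoc, h]

lemma EquivariantObject.finite_hom (X Y : EquivariantObject ρ)
    [Module.Finite k (X.obj ⟶ Y.obj)] : Module.Finite k (X ⟶ Y) :=
  Module.Finite.of_injective
    ({ toFun := fun f => f.hom
       map_add' := fun _ _ => rfl
       map_smul' := fun _ _ => rfl } : (X ⟶ Y) →ₗ[k] (X.obj ⟶ Y.obj))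
    fun _ _ h => EquivariantObject.hom_ext h

instance : (EquivariantObject.forget ρ).PreservesZeroMorphisms where
  map_zero _ _ := rfl

variable [HasFiniteBiproducts C] [Fintype G]

/-- Each `ρ^g` is an equivalence and maps out of a finite direct sum are given componentwise. This
lets the forgetful functor from `T`-modules create cokernels. -/
instance RightAction.preservesColimitsOfShape_sumFunctor {J : Type*} [Category J] :
    PreservesColimitsOfShape J ρ.sumFunctor where
  preservesColimit {K} :=
    { preserves := fun {c} hc => ⟨by
        let cocone (s : Cocone (K ⋙ ρ.sumFunctor)) (g : G) : Cocone (K ⋙ ρ.functor g) :=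
          { pt := s.pt
            ι :=
              { app := fun j => ρ.incl (K.obj j) g ≫ s.ι.app j
                naturality := fun i j f => by
                  have e := ρ.incl_map (K.map f) g
                  have e' := s.w f
                  dsimp only [Functor.comp_map] at e' ⊢
                  rw [← reassoc_of% e, e']
                  exact (comp_id _).symm } }
        have hc' (g : G) := isColimitOfPreserves (ρ.functor g) hc
        exact
          { desc := fun s => ρ.desc fun g => (hc' g).desc (cocone s g)
            fac := fun s j => by
              refine ρ.sum_hom_ext fun g => ?_
              have e : ρ.incl (K.obj j) g ≫ ρ.sumFunctor.map (c.ι.app j) =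
                  (ρ.functor g).map (c.ι.app j) ≫ ρ.incl c.pt g := ρ.incl_map (c.ι.app j) g
              dsimp only [Functor.mapCocone_ι_app]
              rw [reassoc_of% e, ρ.incl_desc]
              exact (hc' g).fac (cocone s g) j
            uniq := fun s m hm => by
              refine ρ.sum_hom_ext fun g => ?_
              rw [ρ.incl_desc]
              refine (hc' g).uniq (cocone s g) _ fun j => ?_
              have e : ρ.incl (K.obj j) g ≫ ρ.sumFunctor.map (c.ι.app j) =
                  (ρ.functor g).map (c.ι.app j) ≫ ρ.incl c.pt g := ρ.incl_map (c.ι.app j) g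
              dsimp only [Functor.mapCocone_ι_app]
              rw [← reassoc_of% e]
              exact congrArg _ (hm j) }⟩ }

instance : (EquivariantObject.forget ρ).PreservesMonomorphisms :=
  have := ρ.isEquivalence_toModules
  inferInstanceAs (ρ.toModules ⋙ ρ.monad.forget).PreservesMonomorphisms

instance : (EquivariantObject.forget ρ).ReflectsIsomorphisms :=
  have := ρ.isEquivalence_toModules
  inferInstanceAs (ρ.toModules ⋙ ρ.monad.forget).ReflectsIsomorphisms

end Equivariant

section Abelian

variable {k : Type w} [Field k] {G : Type*} [Group G] [Fintype G]
  {C : Type u} [Category.{v} C] [Abelian C] [HasFiniteBiproducts C] [Linear k C]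
  (ρ : RightAction k G C)

/-- The monadic forgetful functor creates limits, and also cokernels since `T` preserves them; it is
conservative, so the first isomorphism theorem is inherited from `C`. -/
lemma EquivariantObject.exists_abelian :
    ∃ A : Abelian (EquivariantObject ρ), A.toPreadditive = (inferInstance : Preadditive _) := by
  have := ρ.isEquivalence_toModules
  have : PreservesColimitsOfShape WalkingParallelPair ρ.monad.toFunctor :=
    ρ.preservesColimitsOfShape_sumFunctor
  have h₁ : ∀ (J : Type) [SmallCategory J] [FinCategory J],
      HasLimitsOfShape J ρ.monad.Algebra := fun J _ _ =>
    ⟨fun K => Monad.hasLimit_of_comp_forget_hasLimit K⟩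
  have h₂ : HasColimitsOfShape WalkingParallelPair ρ.monad.Algebra :=
    ⟨fun K => Monad.forget_creates_colimits_of_monad_preserves K⟩
  have h₃ : ∀ (J : Type) [SmallCategory J] [FinCategory J],
      HasLimitsOfShape J (EquivariantObject ρ) := fun J _ _ =>
    Adjunction.hasLimitsOfShape_of_equivalence ρ.toModules
  have h₄ : HasColimitsOfShape WalkingParallelPair (EquivariantObject ρ) :=
    Adjunction.hasColimitsOfShape_of_equivalence ρ.toModules
  have : HasFiniteLimits (EquivariantObject ρ) := ⟨fun J _ _ => h₃ J⟩
  have : HasCokernels (EquivariantObject ρ) := ⟨inferInstance⟩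
  have : PreservesLimitsOfShape WalkingParallelPair (EquivariantObject.forget ρ) :=
    inferInstanceAs (PreservesLimitsOfShape _ (ρ.toModules ⋙ ρ.monad.forget))
  have : PreservesColimitsOfShape WalkingParallelPair (EquivariantObject.forget ρ) :=
    inferInstanceAs (PreservesColimitsOfShape _ (ρ.toModules ⋙ ρ.monad.forget))
  exact exists_abelian_of_conservative (EquivariantObject.forget ρ)

end Abelian

namespace CrossedAction

variable {k : Type w} [Field k] {G Γ : Type*} [Group G] [Group Γ] [Fintype G] [Fintype Γ]
  {M : MatchedPair G Γ} {C : Type u} [Category.{v} C]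

lemma isTensorCategory_equivariantization [P : Preadditive C] [HasFiniteBiproducts C]
    [Linear k C] [MonoidalCategory C] [MonoidalPreadditive C] [Simple (𝟙_ C)]
    (hC : IsTensorCategory k C) (𝒜 : CrossedAction k M C) :
    letI := 𝒜.equivariantMonoidal
    IsTensorCategory k 𝒜.Equivariantization := by
  let := 𝒜.equivariantMonoidal
  have lift {X Y Z : 𝒜.Equivariantization} (m : Y ⟶ Z) [Mono m] (n : X ⟶ Z)
      (f : X.obj ⟶ Y.obj) (h : f ≫ m.hom = n.hom) : ∃ f' : X ⟶ Y, f' ≫ m = n := by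
    have : Mono m.hom := inferInstanceAs (Mono ((EquivariantObject.forget 𝒜.action).map m))
    exact EquivariantObject.exists_lift 𝒜.action m n f h
  exact
    { abelian := by
        obtain ⟨A, rfl⟩ := hC.abelian
        exact EquivariantObject.exists_abelian 𝒜.action
      tensor_bilinear := by
        obtain ⟨_, _⟩ := hC.tensor_bilinear
        have bilinear : MonoidalPreadditive 𝒜.Equivariantization :=
            { whiskerLeft_zero := EquivariantObject.hom_ext MonoidalPreadditive.whiskerLeft_zero
              zero_whiskerRight := EquivariantObject.hom_ext MonoidalPreadditive.zero_whiskerRight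
              whiskerLeft_add := fun f g => EquivariantObject.hom_ext
                (MonoidalPreadditive.whiskerLeft_add f.hom g.hom)
              add_whiskerRight := fun f g => EquivariantObject.hom_ext
                (MonoidalPreadditive.add_whiskerRight f.hom g.hom) }
        exact ⟨bilinear,
            { whiskerLeft_smul := fun X _ _ r f => EquivariantObject.hom_ext
                (MonoidalLinear.whiskerLeft_smul X.obj r f.hom)
              smul_whiskerRight := fun r _ _ f X => EquivariantObject.hom_ext
                (MonoidalLinear.smul_whiskerRight r f.hom X.obj) }⟩
      rigid := by
        obtain ⟨_⟩ := hC.rigid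
        exact ⟨𝒜.equivariantRigid⟩
      noetherian := fun X =>
        isNoetherianObject_of_map (EquivariantObject.forget 𝒜.action) lift (hC.noetherian X.obj)
      artinian := fun X =>
        isArtinianObject_of_map (EquivariantObject.forget 𝒜.action) lift (hC.artinian X.obj)
      finite_hom := fun X Y =>
        have := hC.finite_hom X.obj Y.obj
        EquivariantObject.finite_hom 𝒜.action X Y
      simple_unit :=
        -- Forgetting the action preserves monomorphisms, reflects isomorphisms and detects zero,
        -- and the unit lies over `𝟙_ C`; simplicity is therefore read off in `C`.
        { mono_isIso_iff_nonzero := fun {Y} f _ => by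
            have : Mono f.hom :=
              inferInstanceAs (Mono ((EquivariantObject.forget 𝒜.action).map f))
            have h : IsIso f.hom ↔ f.hom ≠ 0 :=
              @Simple.mono_isIso_iff_nonzero C _ _ (𝟙_ C) _ Y.obj f.hom this
            have h' : IsIso f ↔ IsIso f.hom :=
              (isIso_iff_of_reflects_iso f (EquivariantObject.forget 𝒜.action)).symm
            rw [h', h, not_iff_not]
            exact ⟨fun e => EquivariantObject.hom_ext e, fun e => by rw [e]; rfl⟩ } }

end CrossedAction

end CrossedTensor

end

/-! ### The theorem. -/

theorem theorem5p1 {k : Type w} [Field k] [IsAlgClosed k]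
    {G Γ : Type*} [Group G] [Group Γ] [Fintype G] [Fintype Γ]
    (M : CrossedTensor.MatchedPair G Γ)
    {C : Type u} [Category.{v} C] [Preadditive C] [HasFiniteBiproducts C]
    [Linear k C] [MonoidalCategory C]
    (hC : CrossedTensor.IsTensorCategory k C)
    (𝒜 : CrossedTensor.CrossedAction k M C) :
    ∃ _ : MonoidalCategory 𝒜.Equivariantization,
      CrossedTensor.IsTensorCategory k 𝒜.Equivariantization ∧
      ∃ h : 𝒜.IsTwistedMonoidal,
      ∃ O : 𝒜.action.monad.toFunctor.OplaxMonoidal,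
        (∀ (X Y : C) (D : CrossedTensor.Decomposition 𝒜.grading.comp Y),
          O.δ X Y = 𝒜.comulApp X D) ∧
        O.η = 𝒜.counitHom ∧
        CrossedTensor.IsHopfMonad 𝒜.action.monad O ∧
        𝒜.action.toModules.IsEquivalence ∧
        ∀ A B : 𝒜.Equivariantization,
          (𝒜.action.toModules.obj (A ⊗ B)).a =
            𝒜.action.monad.map (eqToHom (h.tensor_obj A B)) ≫ O.δ A.obj B.obj ≫
              ((𝒜.action.toModules.obj A).a ⊗ₘ (𝒜.action.toModules.obj B).a) ≫
              eqToHom (h.tensor_obj A B).symm := by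
  obtain ⟨_, _⟩ := hC.tensor_bilinear
  have := hC.simple_unit
  refine ⟨𝒜.equivariantMonoidal, 𝒜.isTensorCategory_equivariantization hC, 𝒜.isTwistedMonoidal,
    𝒜.monadOplaxMonoidal, fun X Y D => 𝒜.comul_eq_comulOf X D, rfl, 𝒜.isHopfMonad,
    𝒜.action.isEquivalence_toModules, fun A B => ?_⟩
  -- The underlying object of `A ⊗ B` is definitionally `A.obj ⊗ B.obj`, so every `eqToHom` is an
  -- identity; it remains to reassemble a map out of `T` from its components.
  change 𝒜.action.desc (fun g => 𝒜.action.incl (A.obj ⊗ B.obj) g ≫ 𝒜.comul A.obj B.obj ≫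
      (𝒜.action.desc A.act ⊗ₘ 𝒜.action.desc B.act)) =
    𝒜.action.sumFunctor.map (𝟙 (A.obj ⊗ B.obj)) ≫ 𝒜.comul A.obj B.obj ≫
      (𝒜.action.desc A.act ⊗ₘ 𝒜.action.desc B.act) ≫ 𝟙 (A.obj ⊗ B.obj)
  rw [CategoryTheory.Functor.map_id, id_comp, comp_id, 𝒜.action.desc_incl]
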